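/- **Setting.** Let $W^1,W^2,\dots$ be independent standard Brownian motions on a probability space $(\Omega,\mathcal F,P)$, let $\mathcal F_0\subset\mathcal F$ be a $\sigma$-field independent of $(W^j)_{j\ge1}$, and put $\mathcal F_t=\mathcal F_0\vee\sigma(W^j_s: j\ge 1,\ s\le t)$. Let $\phi_1,\phi_2,\dots:\mathbb R\to\mathbb R$. For every $n$ let $p_n\in\mathbb N$, let $\Theta^0=\Theta^{0,(n)}$ be a deterministic $p_n\times p_n$ matrix with rows $\Theta^0_i=(\Theta^0_{ij})_j$, let $\sigma^0_1,\dots,\sigma^0_{p_n}\in\mathbb R$, and let $X=X^{(n)}$ be a continuous process, adapted to $(\mathcal F_t)$ up to null sets, with $X_0$ $\mathcal F_0$-measurable, such that almost surely $$X^i_t=X^i_0+\int_0^t\sum_{j=1}^{p_n}\Theta^0_{ij}\,\phi_j(X^j_s)\,ds+\sigma^0_iW^i_t,\qquad t\ge0,\ 1\le i\le p_n .$$ ($\Theta^0_{ij}$, $\sigma_i^0$, $X^i$ may, but need not, depend on $n$.) Let $T_0^i=\{j\le p_n:\Theta^0_{ij}\ne0\}$ and $S_i=|T_0^i|$, and assume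 $S_i\le S^*$ for all $n$ and $i\le p_n$, where $S^*$ is a constant. The process is observed at the times $t^n_k=k\Delta_n$, $k=0,\dots,n$, where $\Delta_n>0$. Define $$\hat\sigma_i^2=\frac1{n\Delta_n}\sum_{k=1}^n|X^i_{t^n_k}-X^i_{t^n_{k-1}}|^2,\qquad V_n^i=\frac1{n\hat\sigma_i^2}\sum_{k=1}^n\phi(X_{t^n_{k-1}})\phi(X_{t^n_{k-1}})^T,$$ $$\psi_n^i(\theta)=\frac1{n\Delta_n\hat\sigma_i^2}\sum_{k=1}^n\phi(X_{t^n_{k-1}})\bigl(X^i_{t^n_k}-X^i_{t^n_{k-1}}-\theta^T\phi(X_{t^n_{k-1}})\Delta_n\bigr),\qquad \theta\in\mathbb R^{p_n},$$ where $\phi(x)=(\phi_1(x_1),\dots,\phi_{p_n}(x_{p_n}))^T$. Let $\gamma_n>0$ be of exact order $\log(1+p_n^2)/\sqrt{n\Delta_n}$, that is, $c\,\log(1+p_n^2)/\sqrt{n\Delta_n}\le\gamma_n\le C\log(1+p_n^2)/\sqrt{n\Delta_n}$ for all large $n$ with some constants $0<c\le C<\infty$. The Dantzig selector $\hat\Theta_i$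 is a random vector in $\mathbb R^{p_n}$ which almost surely minimizes $\|\theta\|_1$ over $\{\theta\in\mathbb R^{p_n}:\|\psi_n^i(\theta)\|_\infty\le\gamma_n\}$ (any choice of minimizer is allowed), and $$\hat T_n^i=\{j\le p_n:|\hat\Theta_{ij}|>\gamma_n^{1/2}\}.$$ **Regularity assumption (Assumption 2.1).** (i) $p_n\to\infty$, $\log p_n=o(\sqrt{n\Delta_n})$, and $\Delta_n\asymp n^{-\alpha}$ for some $\alpha\in(1/2,1)$. (ii) There are positive constants $L,L'$ with $|\phi_i(x)|\le L$ and $|\phi_i(x)-\phi_i(y)|\le L'|x-y|$ for all $i\ge1$ and $x,y\in\mathbb R$. (iii) For every real $\nu\ge1$ there is $\tilde C_\nu$ with $E|X^i_t|^\nu\le\tilde C_\nu$ for all $n$, $i\le p_n$, $t\ge0$. (iv) There are positive constants $K_1,K_2,K_3,K_4$, not depending on $n$, such that $|\Theta^0_{ij}|<K_1$ for all $i,j\le p_n$, $|\Theta^0_{ij}|>K_2$ for $j\in T_0^i$, and $K_4<|\sigma^0_i|<K_3$ for all $i\le p_n$. (v) For all $n$ and $i\le p_n$ the process $Y_t=(X^j_t)_{j\in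 T_0^i}$ is ergodic with some invariant probability measure $\mu_0^i$ on $\mathbb R^{S_i}$: $\frac1T\int_0^Tg(Y_t)\,dt\to\int g\,d\mu_0^i$ in probability as $T\to\infty$ for every bounded measurable $g$. **Compatibility assumption (Assumption 4.5).** For $T\subset\{1,\dots,p_n\}$ let $C_T=\{h\in\mathbb R^{p_n}:\|h_{T^c}\|_1\le\|h_T\|_1\}$, and let $$\kappa(T_0^i,V_n^i)=\inf_{0\ne h\in C_{T_0^i}}\frac{S_i^{1/2}(h^TV_n^ih)^{1/2}}{\|h_{T_0^i}\|_1}\qquad(\inf\emptyset=+\infty).$$ For every $\epsilon>0$ there are $\delta>0$ and $n_0\in\mathbb N$ such that $P\bigl(\inf_{1\le i\le p_n}\kappa(T_0^i,V_n^i)>\delta\bigr)\ge1-\epsilon$ for all $n\ge n_0$. **Theorem 5.1.** Under these assumptions, $$\lim_{n\to\infty}P\bigl(\hat T_n^i=T_0^i\ \text{for all}\ i\in\{1,\dots,p_n\}\bigr)=1 .$$ -/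

import Mathlib

open MeasureTheory ProbabilityTheory Filter Topology Asymptotics
open scoped NNReal ENNReal Matrix

noncomputable section

namespace DantzigDiffusion

/-! ### The stochastic basis -/

/-- The `σ`-field generated by `W_s^j` for all `j` and all `s ∈ [0, t]`. -/
abbrev noiseSigma {Ω : Type*} (W : ℕ → ℝ≥0 → Ω → ℝ) (t : ℝ≥0) : MeasurableSpace Ω :=
  ⨆ j : ℕ, ⨆ s : Set.Iic t, MeasurableSpace.comap (W j s) (borel ℝ)

/-- `F_t = F_0 ∨ σ(W_s^j, j = 1, 2, … : s ∈ [0, t])`. -/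
abbrev basisSigma {Ω : Type*} (F₀ : MeasurableSpace Ω) (W : ℕ → ℝ≥0 → Ω → ℝ) (t : ℝ≥0) :
    MeasurableSpace Ω :=
  F₀ ⊔ noiseSigma W t

/-- `W^1, W^2, …` are independent standard Brownian motions, and `F_0` is a sub-`σ`-field that is
independent of all of them jointly. -/
structure IsDrivingNoise {Ω : Type*} (F₀ : MeasurableSpace Ω) [mΩ : MeasurableSpace Ω]
    (W : ℕ → ℝ≥0 → Ω → ℝ) (P : Measure Ω) : Prop where
  measurable : ∀ j t, Measurable (W j t)
  brownian : ∀ j, IsBrownianReal (W j) P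
  indep : iIndepFun (fun (j : ℕ) (ω : Ω) (t : ℝ≥0) => W j t ω) P
  initial_le : F₀ ≤ mΩ
  initial_indep : Indep F₀ (⨆ t : ℝ≥0, noiseSigma W t) P

/-! ### The diffusion model -/

/-- `φ(x) = (φ_1(x_1), …, φ_p(x_p))`. -/
def phiVec {p : ℕ} (φ : ℕ → ℝ → ℝ) (x : Fin p → ℝ) : Fin p → ℝ :=
  fun j => φ j (x j)

/-- `X` is a continuous adapted solution of the `p`-dimensional equation
`X_t^i = X_0^i + ∫_0^t Θ_iᵀ φ(X_s) ds + σ_i W_t^i`, `i = 1, …, p`, where `Θ_i = (Θ_ij)_j`, with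
`F_0`-measurable initial value.  Adaptedness is understood up to `P`-null sets, so that it does not
matter whether the filtration has been completed. -/
structure IsSolution {Ω : Type*} {p : ℕ} (F₀ : MeasurableSpace Ω) [mΩ : MeasurableSpace Ω]
    (W : ℕ → ℝ≥0 → Ω → ℝ) (φ : ℕ → ℝ → ℝ) (Θ : Matrix (Fin p) (Fin p) ℝ) (σ : Fin p → ℝ)
    (X : ℝ≥0 → Ω → Fin p → ℝ) (P : Measure Ω) : Prop where
  initial : ∀ i, Measurable[F₀] (fun ω => X 0 ω i)
  adapted : ∀ t i, AEStronglyMeasurable[basisSigma F₀ W t] (fun ω => X t ω i) P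
  continuous : ∀ᵐ ω ∂P, Continuous (fun t => X t ω)
  equation : ∀ᵐ ω ∂P, ∀ (t : ℝ≥0) (i : Fin p),
    X t ω i = X 0 ω i + (∫ s in (0 : ℝ)..(t : ℝ), Θ i ⬝ᵥ phiVec φ (X s.toNNReal ω))
      + σ i * W i t ω

/-- The support `{j : θ_j ≠ 0}` of a vector. -/
def supp {p : ℕ} (θ : Fin p → ℝ) : Finset (Fin p) :=
  Finset.univ.filter (fun j => θ j ≠ 0)

/-- The process `Y` is ergodic with invariant probability measure `μ`: for every bounded measurable
`g`, `T⁻¹ ∫_0^T g(Y_t) dt` converges in probability to `∫ g dμ` as `T → ∞`. -/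
structure IsErgodicWith {Ω E : Type*} [MeasurableSpace Ω] [MeasurableSpace E]
    (Y : ℝ≥0 → Ω → E) (μ : Measure E) (P : Measure Ω) : Prop where
  isProbabilityMeasure : IsProbabilityMeasure μ
  tendsto : ∀ g : E → ℝ, Measurable g → (∃ M : ℝ, ∀ y, |g y| ≤ M) →
    TendstoInMeasure P (fun (T : ℝ) (ω : Ω) => T⁻¹ * ∫ t in (0 : ℝ)..T, g (Y t.toNNReal ω))
      atTop (fun _ => ∫ y, g y ∂μ)

/-- The regularity conditions on the sequence of models (`n` is the number of observed increments,
`p n` the dimension, `Δ n` the mesh, `Θ n`, `σ n` the true parameters, `X n` the process). -/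
structure Regularity {Ω : Type*} [MeasurableSpace Ω] (p : ℕ → ℕ) (Δ : ℕ → ℝ≥0)
    (φ : ℕ → ℝ → ℝ) (Θ : ∀ n, Matrix (Fin (p n)) (Fin (p n)) ℝ) (σ : ∀ n, Fin (p n) → ℝ)
    (X : ∀ n, ℝ≥0 → Ω → Fin (p n) → ℝ) (P : Measure Ω) : Prop where
  dim_tendsto : Tendsto p atTop atTop
  log_dim : (fun n => Real.log (p n)) =o[atTop] (fun n : ℕ => √((n : ℝ) * Δ n))
  mesh : ∃ α : ℝ, 1 / 2 < α ∧ α < 1 ∧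
    (fun n => (Δ n : ℝ)) =Θ[atTop] (fun n : ℕ => (n : ℝ) ^ (-α))
  phi_bounded : ∃ L : ℝ, 0 < L ∧ ∀ i x, |φ i x| ≤ L
  phi_lipschitz : ∃ L' : ℝ, 0 < L' ∧ ∀ i x y, |φ i x - φ i y| ≤ L' * |x - y|
  moments : ∀ ν : ℝ, 1 ≤ ν → ∃ C : ℝ, ∀ n t i,
    ∫⁻ ω, ENNReal.ofReal (|X n t ω i| ^ ν) ∂P ≤ ENNReal.ofReal C
  drift_bounds : ∃ K₁ K₂ : ℝ, 0 < K₁ ∧ 0 < K₂ ∧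
    (∀ n i j, |Θ n i j| < K₁) ∧ (∀ n i, ∀ j ∈ supp (Θ n i), K₂ < |Θ n i j|)
  diffusion_bounds : ∃ K₃ K₄ : ℝ, 0 < K₃ ∧ 0 < K₄ ∧ ∀ n i, K₄ < |σ n i| ∧ |σ n i| < K₃
  ergodic : ∀ n i, ∃ μ : Measure (supp (Θ n i) → ℝ),
    IsErgodicWith (fun t ω (j : supp (Θ n i)) => X n t ω j) μ P

/-! ### The estimators, as functions of the data `x k = X_{t_k^n}`, `k = 0, …, n` -/

/-- `σ̂_i² = (n Δ)⁻¹ ∑_{k=1}^n |x_k^i - x_{k-1}^i|²`. -/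
def sigmaSqHat {p : ℕ} (n : ℕ) (Δ : ℝ) (x : ℕ → Fin p → ℝ) (i : Fin p) : ℝ :=
  1 / (n * Δ) * ∑ k ∈ Finset.range n, |x (k + 1) i - x k i| ^ 2

/-- The score
`ψ_n(θ) = (n Δ σ̂_i²)⁻¹ ∑_{k=1}^n φ(x_{k-1}) (x_k^i - x_{k-1}^i - θᵀ φ(x_{k-1}) Δ)`
of the `i`-th row. -/
def score {p : ℕ} (φ : ℕ → ℝ → ℝ) (n : ℕ) (Δ : ℝ) (x : ℕ → Fin p → ℝ) (i : Fin p)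
    (θ : Fin p → ℝ) : Fin p → ℝ :=
  (1 / (n * Δ * sigmaSqHat n Δ x i)) • ∑ k ∈ Finset.range n,
    (x (k + 1) i - x k i - (θ ⬝ᵥ phiVec φ (x k)) * Δ) • phiVec φ (x k)

/-- The Hessian `V_n^i = (n σ̂_i²)⁻¹ ∑_{k=1}^n φ(x_{k-1}) φ(x_{k-1})ᵀ`. -/
def hessian {p : ℕ} (φ : ℕ → ℝ → ℝ) (n : ℕ) (Δ : ℝ) (x : ℕ → Fin p → ℝ) (i : Fin p) :
    Matrix (Fin p) (Fin p) ℝ :=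
  (1 / (n * sigmaSqHat n Δ x i)) • ∑ k ∈ Finset.range n,
    Matrix.vecMulVec (phiVec φ (x k)) (phiVec φ (x k))

/-- `‖h_T‖_1`, the `ℓ_1` norm of the sub-vector of `h` with index set `T`. -/
def l1On {p : ℕ} (T : Finset (Fin p)) (h : Fin p → ℝ) : ℝ :=
  ∑ j ∈ T, |h j|

/-- The constraint set `{θ ∈ ℝ^p : ‖ψ_n(θ)‖_∞ ≤ γ}`; the norm of `Fin p → ℝ` is the sup norm. -/
def feasibleSet {p : ℕ} (φ : ℕ → ℝ → ℝ) (n : ℕ) (Δ γ : ℝ) (x : ℕ → Fin p → ℝ) (i : Fin p) :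
    Set (Fin p → ℝ) :=
  {θ | ‖score φ n Δ x i θ‖ ≤ γ}

/-- `θ` is a Dantzig selector of the `i`-th row: a minimizer of `‖θ‖_1` over the constraint set. -/
def IsDantzigSelector {p : ℕ} (φ : ℕ → ℝ → ℝ) (n : ℕ) (Δ γ : ℝ) (x : ℕ → Fin p → ℝ)
    (i : Fin p) (θ : Fin p → ℝ) : Prop :=
  θ ∈ feasibleSet φ n Δ γ x i ∧
    ∀ θ' ∈ feasibleSet φ n Δ γ x i, l1On Finset.univ θ ≤ l1On Finset.univ θ'

/-- The thresholded support `{j : |θ_j| > γ^{1/2}}`. -/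
def thresholdSupp {p : ℕ} (γ : ℝ) (θ : Fin p → ℝ) : Finset (Fin p) :=
  Finset.univ.filter (fun j => √γ < |θ j|)

/-! ### The compatibility condition -/

/-- The cone `C_T = {h : ‖h_{Tᶜ}‖_1 ≤ ‖h_T‖_1}`. -/
def cone {p : ℕ} (T : Finset (Fin p)) : Set (Fin p → ℝ) :=
  {h | l1On Tᶜ h ≤ l1On T h}

/-- The compatibility factor
`κ(T, V) = inf_{0 ≠ h ∈ C_T} |T|^{1/2} (hᵀ V h)^{1/2} / ‖h_T‖_1`, with values in `[0, ∞]` (for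
`T = ∅` the infimum is over the empty set and equals `∞`). -/
def kappa {p : ℕ} (T : Finset (Fin p)) (V : Matrix (Fin p) (Fin p) ℝ) : ℝ≥0∞ :=
  ⨅ h ∈ {h : Fin p → ℝ | h ≠ 0 ∧ h ∈ cone T},
    ENNReal.ofReal (√(T.card : ℝ) * √(h ⬝ᵥ (V *ᵥ h)) / l1On T h)

/-- The data `x_k = X_{t_k^n}` with `t_k^n = k Δ_n`. -/
def observe {Ω : Type*} {p : ℕ} (Δ : ℝ≥0) (X : ℝ≥0 → Ω → Fin p → ℝ) (ω : Ω) :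
    ℕ → Fin p → ℝ :=
  fun k => X (k * Δ) ω

/-- For every `ε > 0` there are `δ > 0` and `n₀` such that
`P(inf_{i ≤ p_n} κ(T_0^i, V_n^i) > δ) ≥ 1 - ε` for all `n ≥ n₀`. -/
def CompatibilityCondition {Ω : Type*} [MeasurableSpace Ω] (p : ℕ → ℕ) (Δ : ℕ → ℝ≥0)
    (φ : ℕ → ℝ → ℝ) (Θ : ∀ n, Matrix (Fin (p n)) (Fin (p n)) ℝ)
    (X : ∀ n, ℝ≥0 → Ω → Fin (p n) → ℝ) (P : Measure Ω) : Prop :=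
  ∀ ε : ℝ, 0 < ε → ∃ δ : ℝ, 0 < δ ∧ ∃ n₀ : ℕ, ∀ n ≥ n₀,
    ENNReal.ofReal (1 - ε) ≤ P {ω | ENNReal.ofReal δ <
      ⨅ i : Fin (p n), kappa (supp (Θ n i)) (hessian φ n (Δ n) (observe (Δ n) (X n) ω) i)}

end DantzigDiffusion

end

/-!
Only three features of the driving noise matter: stochastic sums with bounded integrands have
Gaussian tails, the average deviation of a Brownian motion from its values on a grid of mesh `Δ`
is of order `√Δ` with exponential tails, and realized quadratic variations are bounded below with
exponentially high probability. Write `q = log (1 + p²)`. All three tails hold with probability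
`1 - O(e^{-3q})`, and a union bound over the at most `p²` coordinates costs a factor `e^q`
(`measure_exceptionalSet_le`). The independence behind these tails is that of the increments of
`W^i` from the whole past `F₀ ∨ σ(W_s^j : s ≤ t)` (`indep_increment`), which turns exponential
moments of sums into products (`lintegral_prod_le_pow`).

Outside the exceptional event `σ̂_i²` is bounded below uniformly in `i`, and the score at the true
row is the sum of a stochastic part, at most a small multiple of `q / √(nΔ)`, and of a
discretization error of order `q √Δ` (`IsBoundedPath.norm_score_le`). The latter is negligible
because `√n Δ → 0`; hence the true row is feasible for `γ ≍ q / √(nΔ)`.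

When the true row `θ₀` is feasible, the error `h = θ̂ - θ₀` of the Dantzig selector lies in the cone
of the support and satisfies `‖V h‖_∞ ≤ 2γ`, so a lower bound `δ` for the compatibility factor
gives `‖h‖₁ ≤ 8 S γ / δ²` (`l1On_dantzig_sub_le`). Since `γ → 0`, this is below `√γ`, while the
nonzero entries of `θ₀` stay above `2√γ`, and thresholding at `√γ` recovers the support
(`thresholdSupp_eq_supp`). The event of the compatibility condition need not
be measurable: all estimates use `P` as an outer measure.
-/

open MeasureTheory ProbabilityTheory Filter Topology Asymptotics
open scoped NNReal ENNReal Matrix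

namespace DantzigDiffusion

/-! ### Independence of the Brownian increments from the past -/

/-- If `H` is independent of `A`, and `H ∨ A` of `B`, then `H` is independent of `A ∨ B`. The sets
`a ∩ b` with `a ∈ A` and `b ∈ B` form a `π`-system generating `A ∨ B`. -/
lemma indep_sup_right {Ω : Type*} {mΩ : MeasurableSpace Ω} {P : Measure Ω}
    [IsProbabilityMeasure P] {H A B : MeasurableSpace Ω} (hH : H ≤ mΩ) (hA : A ≤ mΩ) (hB : B ≤ mΩ)
    (h₁ : Indep H A P) (h₂ : Indep (H ⊔ A) B P) : Indep H (A ⊔ B) P := by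
  have hHA : H ≤ H ⊔ A := le_sup_left
  have hAA : A ≤ H ⊔ A := le_sup_right
  refine IndepSets.indep (p1 := {s | MeasurableSet[H] s})
    (p2 := {s | ∃ a b, MeasurableSet[A] a ∧ MeasurableSet[B] b ∧ s = a ∩ b})
    hH (sup_le hA hB) (@MeasurableSpace.isPiSystem_measurableSet Ω H) ?_ ?_ ?_ ?_
  · rintro _ ⟨a, b, ha, hb, rfl⟩ _ ⟨a', b', ha', hb', rfl⟩ -
    exact ⟨a ∩ a', b ∩ b', ha.inter ha', hb.inter hb', Set.inter_inter_inter_comm a b a' b'⟩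
  · exact (@MeasurableSpace.generateFrom_measurableSet Ω H).symm
  · apply le_antisymm
    · refine sup_le (fun s hs => ?_) (fun s hs => ?_)
      · exact MeasurableSpace.measurableSet_generateFrom
          ⟨s, Set.univ, hs, MeasurableSet.univ, by simp⟩
      · exact MeasurableSpace.measurableSet_generateFrom
          ⟨Set.univ, s, MeasurableSet.univ, hs, by simp⟩
    · refine MeasurableSpace.generateFrom_le ?_
      rintro _ ⟨a, b, ha, hb, rfl⟩
      exact MeasurableSet.inter ((le_sup_left : A ≤ A ⊔ B) a ha) ((le_sup_right : B ≤ A ⊔ B) b hb)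
  · rw [IndepSets_iff]
    rintro h _ hh ⟨a, b, ha, hb, rfl⟩
    rw [Indep_iff] at h₁ h₂
    rw [← Set.inter_assoc, h₂ (h ∩ a) b ((hHA h hh).inter (hAA a ha)) hb, h₁ h a hh ha,
      h₂ a b (hAA a ha) hb, mul_assoc]

lemma basisSigma_mono {Ω : Type*} (F₀ : MeasurableSpace Ω) (W : ℕ → ℝ≥0 → Ω → ℝ)
    {s t : ℝ≥0} (h : s ≤ t) : basisSigma F₀ W s ≤ basisSigma F₀ W t :=
  sup_le_sup_left (iSup_mono fun j => iSup_le fun u : Set.Iic s =>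
    le_iSup (fun v : Set.Iic t => MeasurableSpace.comap (W j v) (borel ℝ))
      ⟨u.1, le_trans u.2 h⟩) F₀

lemma measurable_basisSigma {Ω : Type*} (F₀ : MeasurableSpace Ω) (W : ℕ → ℝ≥0 → Ω → ℝ)
    (j : ℕ) {s t : ℝ≥0} (h : s ≤ t) :
    Measurable[basisSigma F₀ W t] (W j s) := by
  have h1 : MeasurableSpace.comap (W j s) (borel ℝ) ≤ basisSigma F₀ W t :=
    le_trans (le_trans (le_iSup (fun v : Set.Iic t => MeasurableSpace.comap (W j v) (borel ℝ))
      ⟨s, h⟩) (le_iSup (fun j => ⨆ v : Set.Iic t, MeasurableSpace.comap (W j v) (borel ℝ)) j))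
      le_sup_right
  rw [← BorelSpace.measurable_eq (α := ℝ)] at h1
  exact measurable_iff_comap_le.2 h1

variable {Ω : Type*} {F₀ : MeasurableSpace Ω} [mΩ : MeasurableSpace Ω] {P : Measure Ω}
  {W : ℕ → ℝ≥0 → Ω → ℝ}

lemma basisSigma_le (hW : IsDrivingNoise F₀ W P) (t : ℝ≥0) : basisSigma F₀ W t ≤ mΩ :=
  sup_le hW.initial_le (iSup_le fun j => iSup_le fun s => by
    have := (hW.measurable j s).comap_le
    rwa [← BorelSpace.measurable_eq (α := ℝ)])

/-- The `σ`-field generated by the whole path of `W^j`. -/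
abbrev pathSigma {Ω : Type*} (W : ℕ → ℝ≥0 → Ω → ℝ) (j : ℕ) : MeasurableSpace Ω :=
  MeasurableSpace.comap (fun ω (t : ℝ≥0) => W j t ω) MeasurableSpace.pi

/-- The `σ`-field generated by the path of `W^j` up to time `s`. -/
abbrev pastSigma {Ω : Type*} (W : ℕ → ℝ≥0 → Ω → ℝ) (j : ℕ) (s : ℝ≥0) : MeasurableSpace Ω :=
  MeasurableSpace.comap (fun ω (t : Set.Iic s) => W j t ω) MeasurableSpace.pi

/-- The `σ`-field generated by the increments of `W^j` after time `s`. -/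
abbrev futureSigma {Ω : Type*} (W : ℕ → ℝ≥0 → Ω → ℝ) (j : ℕ) (s : ℝ≥0) : MeasurableSpace Ω :=
  MeasurableSpace.comap (fun ω (t : ℝ≥0) => W j (s + t) ω - W j s ω) MeasurableSpace.pi

/-- The `σ`-field generated by the paths of all `W^j` with `j ≠ i`. -/
abbrev othersSigma {Ω : Type*} (W : ℕ → ℝ≥0 → Ω → ℝ) (i : ℕ) : MeasurableSpace Ω :=
  ⨆ j ∈ ({i}ᶜ : Set ℕ), pathSigma W j

lemma measurable_pathSigma {Ω : Type*} (W : ℕ → ℝ≥0 → Ω → ℝ) (j : ℕ) (t : ℝ≥0) :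
    Measurable[pathSigma W j] (W j t) :=
  (measurable_pi_apply t).comp (comap_measurable (fun ω (t : ℝ≥0) => W j t ω))

lemma pathSigma_le_iSup_noiseSigma {Ω : Type*} (W : ℕ → ℝ≥0 → Ω → ℝ) (j : ℕ) :
    pathSigma W j ≤ ⨆ t : ℝ≥0, noiseSigma W t := by
  refine Measurable.comap_le (@measurable_pi_lambda _ _ _ (_) _ _ fun t => ?_)
  refine measurable_iff_comap_le.2 (le_trans ?_ (le_iSup _ t))
  rw [BorelSpace.measurable_eq (α := ℝ)]
  exact le_trans (le_iSup (fun v : Set.Iic t => MeasurableSpace.comap (W j v) (borel ℝ))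
    ⟨t, le_refl t⟩) (le_iSup (fun j => ⨆ v : Set.Iic t, MeasurableSpace.comap (W j v) (borel ℝ)) j)

lemma pastSigma_le_pathSigma {Ω : Type*} (W : ℕ → ℝ≥0 → Ω → ℝ) (j : ℕ) (s : ℝ≥0) :
    pastSigma W j s ≤ pathSigma W j :=
  Measurable.comap_le (@measurable_pi_lambda _ _ _ (_) _ _ fun _ => measurable_pathSigma W j _)

lemma futureSigma_le_pathSigma {Ω : Type*} (W : ℕ → ℝ≥0 → Ω → ℝ) (j : ℕ) (s : ℝ≥0) :
    futureSigma W j s ≤ pathSigma W j :=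
  Measurable.comap_le (@measurable_pi_lambda _ _ _ (_) _ _ fun _ =>
    (measurable_pathSigma W j _).sub (measurable_pathSigma W j _))

/-- The past `basisSigma F₀ W s` is generated by the past of `W^i`, the pasts of the other
`W^j`, and `F₀`; these are adjoined one at a time by `indep_sup_right`. -/
lemma indep_increment (hW : IsDrivingNoise F₀ W P) [IsProbabilityMeasure P]
    (i : ℕ) (s u : ℝ≥0) :
    Indep (MeasurableSpace.comap (fun ω => W i (s + u) ω - W i s ω) (borel ℝ))
      (basisSigma F₀ W s) P := by
  have path_le (j : ℕ) : pathSigma W j ≤ mΩ :=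
    Measurable.comap_le (measurable_pi_lambda _ fun t => hW.measurable j t)
  have hH := futureSigma_le_pathSigma W i s
  have hA := pastSigma_le_pathSigma W i s
  have hB : othersSigma W i ≤ mΩ := iSup₂_le fun j _ => path_le j
  have hHA : Indep (futureSigma W i s) (pastSigma W i s) P := (hW.brownian i).indepFun_shift s
  have hHAB : Indep (futureSigma W i s ⊔ pastSigma W i s) (othersSigma W i) P := by
    have h := indep_iSup_of_disjoint (m := pathSigma W) path_le hW.indep
      (disjoint_compl_right : Disjoint ({i} : Set ℕ) {i}ᶜ)
    refine indep_of_indep_of_le_left h ?_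
    simpa using ⟨hH, hA⟩
  have h₁ : Indep (futureSigma W i s) (pastSigma W i s ⊔ othersSigma W i) P :=
    indep_sup_right (hH.trans (path_le i)) (hA.trans (path_le i)) hB hHA hHAB
  have h₂ : Indep (futureSigma W i s ⊔ (pastSigma W i s ⊔ othersSigma W i)) F₀ P := by
    refine indep_of_indep_of_le_left hW.initial_indep.symm ?_
    exact sup_le (hH.trans (pathSigma_le_iSup_noiseSigma W i))
      (sup_le (hA.trans (pathSigma_le_iSup_noiseSigma W i))
        (iSup₂_le fun j _ => pathSigma_le_iSup_noiseSigma W j))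
  have h₃ := indep_sup_right (hH.trans (path_le i)) (sup_le (hA.trans (path_le i)) hB)
    hW.initial_le h₁ h₂
  refine indep_of_indep_of_le h₃ ?_ ?_
  · rw [← BorelSpace.measurable_eq (α := ℝ)]
    exact Measurable.comap_le ((measurable_pi_apply u).comp
      (comap_measurable (fun ω (t : ℝ≥0) => W i (s + t) ω - W i s ω)))
  · refine sup_le le_sup_right (iSup_le fun j => iSup_le fun t => ?_)
    refine le_trans ?_ le_sup_left
    rw [← BorelSpace.measurable_eq (α := ℝ)]
    by_cases hj : j = i
    · subst hj
      refine le_trans ?_ le_sup_left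
      exact Measurable.comap_le ((measurable_pi_apply t).comp
        (comap_measurable (fun ω (t : Set.Iic s) => W j t ω)))
    · refine le_trans (measurable_pathSigma W j t).comap_le (le_trans ?_ le_sup_right)
      exact le_iSup₂ (f := fun j (_ : j ∈ ({i}ᶜ : Set ℕ)) => pathSigma W j) j hj

/-! ### Exponential moments along a filtration -/

/-- If `ξ k` has law `ν` and is independent of the past `𝒢 k`, which determines `f k`, then the
expectation of `∏ k < n, F (f k, ξ k)` is at most `c ^ n` as soon as `∫ F (a, x) dν(x) ≤ c` for
every frozen value `a` of the past. -/
lemma lintegral_prod_le_pow [IsProbabilityMeasure P] {𝒢 : ℕ → MeasurableSpace Ω}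
    (h𝒢 : ∀ k, 𝒢 k ≤ mΩ) (h𝒢m : Monotone 𝒢) {f ξ : ℕ → Ω → ℝ}
    (hf : ∀ k, Measurable[𝒢 k] (f k)) (hξ : ∀ k, Measurable[𝒢 (k + 1)] (ξ k))
    (hind : ∀ k, Indep (MeasurableSpace.comap (ξ k) inferInstance) (𝒢 k) P)
    {ν : Measure ℝ} (hν : ∀ k, P.map (ξ k) = ν)
    {F : ℝ × ℝ → ℝ≥0∞} (hF : Measurable F) {c : ℝ≥0∞} (hc : ∀ a, ∫⁻ x, F (a, x) ∂ν ≤ c) (n : ℕ) :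
    ∫⁻ ω, ∏ k ∈ Finset.range n, F (f k ω, ξ k ω) ∂P ≤ c ^ n := by
  induction n with
  | zero => simp
  | succ n ih =>
    have hZ : Measurable[𝒢 n] (fun ω => ∏ k ∈ Finset.range n, F (f k ω, ξ k ω)) := by
      refine Finset.measurable_fun_prod _ fun k hk => ?_
      have hk : k + 1 ≤ n := Finset.mem_range.1 hk
      exact hF.comp (Measurable.prodMk ((hf k).mono (h𝒢m (by omega)) le_rfl)
        ((hξ k).mono (h𝒢m hk) le_rfl))
    have hpair : Measurable[𝒢 n]
        (fun ω => (∏ k ∈ Finset.range n, F (f k ω, ξ k ω), f n ω)) := hZ.prodMk (hf n)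
    have hpair' := hpair.mono (h𝒢 n) le_rfl
    have hξ' : Measurable (ξ n) := (hξ n).mono (h𝒢 _) le_rfl
    have hI : IndepFun (fun ω => (∏ k ∈ Finset.range n, F (f k ω, ξ k ω), f n ω)) (ξ n) P :=
      (indep_of_indep_of_le_right (hind n) hpair.comap_le).symm
    have hmap := hI.map_prod_eq_prod_map_map hpair'.aemeasurable hξ'.aemeasurable
    have hνp : IsProbabilityMeasure ν := by
      rw [← hν n]; exact Measure.isProbabilityMeasure_map hξ'.aemeasurable
    let G : (ℝ≥0∞ × ℝ) × ℝ → ℝ≥0∞ := fun y => y.1.1 * F (y.1.2, y.2)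
    have hG : Measurable G := by
      refine (measurable_fst.comp measurable_fst).mul (hF.comp ?_)
      exact (measurable_snd.comp measurable_fst).prodMk measurable_snd
    calc ∫⁻ ω, ∏ k ∈ Finset.range (n + 1), F (f k ω, ξ k ω) ∂P
        = ∫⁻ ω, G ((∏ k ∈ Finset.range n, F (f k ω, ξ k ω), f n ω), ξ n ω) ∂P := by
          simp only [Finset.prod_range_succ, G]
      _ = ∫⁻ y, ∫⁻ x, G (y, x) ∂ν
            ∂(P.map (fun ω => (∏ k ∈ Finset.range n, F (f k ω, ξ k ω), f n ω))) := by
          rw [← lintegral_map hG (hpair'.prodMk hξ'), hmap, hν n,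
            lintegral_prod _ hG.aemeasurable]
      _ ≤ ∫⁻ y, y.1 * c
            ∂(P.map (fun ω => (∏ k ∈ Finset.range n, F (f k ω, ξ k ω), f n ω))) := by
          refine lintegral_mono fun y => ?_
          simp only [G]
          rw [lintegral_const_mul _ (by fun_prop)]
          gcongr
          exact hc _
      _ = (∫⁻ ω, ∏ k ∈ Finset.range n, F (f k ω, ξ k ω) ∂P) * c := by
          rw [lintegral_map (by fun_prop) hpair', lintegral_mul_const _ (hZ.mono (h𝒢 n) le_rfl)]
      _ ≤ c ^ (n + 1) := by rw [pow_succ]; gcongr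

lemma lintegral_exp_mul_gaussianReal (v : ℝ≥0) (s : ℝ) :
    ∫⁻ x, ENNReal.ofReal (Real.exp (s * x)) ∂(gaussianReal 0 v)
      = ENNReal.ofReal (Real.exp (v * s ^ 2 / 2)) := by
  rw [← ofReal_integral_eq_lintegral_ofReal (integrable_exp_mul_gaussianReal s)
    (ae_of_all _ fun x => (Real.exp_pos _).le)]
  have h := congrFun (mgf_fun_id_gaussianReal (μ := 0) (v := v)) s
  rw [mgf] at h
  rw [h]; simp

lemma lintegral_exp_neg_sq_gaussianReal {v : ℝ≥0} (hv : v ≠ 0) :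
    ∫⁻ x, ENNReal.ofReal (Real.exp (-(x ^ 2 / v))) ∂(gaussianReal 0 v)
      = ENNReal.ofReal (√3)⁻¹ := by
  have hv' : (0 : ℝ) < v := by positivity
  have hint : Integrable (fun x : ℝ => Real.exp (-(x ^ 2 / v))) (gaussianReal 0 v) := by
    refine Integrable.of_bound (C := 1) (by fun_prop) (ae_of_all _ fun x => ?_)
    rw [Real.norm_of_nonneg (Real.exp_pos _).le, Real.exp_le_one_iff]
    have : 0 ≤ x ^ 2 / (v : ℝ) := by positivity
    linarith
  rw [← ofReal_integral_eq_lintegral_ofReal hint (ae_of_all _ fun x => (Real.exp_pos _).le),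
    integral_gaussianReal_eq_integral_smul hv]
  congr 1
  have h : ∀ x : ℝ, gaussianPDFReal 0 v x • Real.exp (-(x ^ 2 / v))
      = (√(2 * Real.pi * v))⁻¹ * Real.exp (-(3 / (2 * v)) * x ^ 2) := by
    intro x
    rw [gaussianPDFReal, smul_eq_mul, mul_assoc, ← Real.exp_add]
    congr 2
    field_simp
    ring
  simp_rw [h]
  rw [integral_const_mul, integral_gaussian, ← Real.sqrt_inv, ← Real.sqrt_mul (by positivity),
    ← Real.sqrt_inv]
  congr 1
  have := Real.pi_pos
  field_simp

/-! ### Tail bounds for functionals of the Brownian motions -/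

/-- Chernoff's bound, for an exponential moment bounded in terms of lower integrals. -/
lemma measure_le_exp_of_lintegral_exp {Z : Ω → ℝ} (hZ : AEMeasurable Z P) {c : ℝ}
    (h : ∫⁻ ω, ENNReal.ofReal (Real.exp (Z ω)) ∂P ≤ ENNReal.ofReal c) (a : ℝ) :
    P {ω | a ≤ Z ω} ≤ ENNReal.ofReal (c * Real.exp (-a)) := by
  have hm : AEMeasurable (fun ω => ENNReal.ofReal (Real.exp (Z ω))) P :=
    (Real.measurable_exp.comp_aemeasurable hZ).ennreal_ofReal
  have h1 := mul_meas_ge_le_lintegral₀ hm (ENNReal.ofReal (Real.exp a))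
  have h2 : {ω | a ≤ Z ω} ⊆
      {ω | ENNReal.ofReal (Real.exp a) ≤ ENNReal.ofReal (Real.exp (Z ω))} := fun ω hω =>
    ENNReal.ofReal_le_ofReal (Real.exp_le_exp.2 hω)
  have h3 : ENNReal.ofReal (Real.exp a) * P {ω | a ≤ Z ω} ≤ ENNReal.ofReal c :=
    (mul_le_mul_right (measure_mono h2) _).trans (h1.trans h)
  calc P {ω | a ≤ Z ω}
      = ENNReal.ofReal (Real.exp (-a)) * (ENNReal.ofReal (Real.exp a) * P {ω | a ≤ Z ω}) := by
        rw [← mul_assoc, ← ENNReal.ofReal_mul (Real.exp_pos _).le, ← Real.exp_add]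
        simp
    _ ≤ ENNReal.ofReal (Real.exp (-a)) * ENNReal.ofReal c := by gcongr
    _ = ENNReal.ofReal (c * Real.exp (-a)) := by
        rw [← ENNReal.ofReal_mul (Real.exp_pos _).le, mul_comm]

lemma map_increment (hW : IsDrivingNoise F₀ W P) (i k : ℕ) (d : ℝ≥0) :
    P.map (fun ω => W i ((k + 1 : ℕ) * d) ω - W i (k * d) ω) = gaussianReal 0 d := by
  have h := ((hW.brownian i).toIsPreBrownianReal.shift (k * d)).hasLaw_eval d
  rw [← h.map_eq]
  congr! 4
  push_cast; ring

lemma indep_increment_grid (hW : IsDrivingNoise F₀ W P) [IsProbabilityMeasure P]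
    (i k : ℕ) (d : ℝ≥0) :
    Indep (MeasurableSpace.comap (fun ω => W i ((k + 1 : ℕ) * d) ω - W i (k * d) ω) inferInstance)
      (basisSigma F₀ W (k * d)) P := by
  have h := indep_increment hW i (k * d) d
  have e : ((k + 1 : ℕ) : ℝ≥0) * d = k * d + d := by push_cast; ring
  rwa [e]

/-- A stochastic sum with integrands bounded by `L` has the exponential moments of a centred
Gaussian variable of variance `n d L²`. -/
lemma lintegral_exp_stochasticSum_le (hW : IsDrivingNoise F₀ W P) [IsProbabilityMeasure P]
    (i : ℕ) (d : ℝ≥0) {f : ℕ → Ω → ℝ} (hf : ∀ k : ℕ, Measurable[basisSigma F₀ W (k * d)] (f k))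
    {g : ℝ → ℝ} (hg : Measurable g) {L : ℝ} (hL : ∀ x, |g x| ≤ L) (s : ℝ) (n : ℕ) :
    ∫⁻ ω, ENNReal.ofReal (Real.exp (s * ∑ k ∈ Finset.range n,
        g (f k ω) * (W i ((k + 1 : ℕ) * d) ω - W i (k * d) ω))) ∂P
      ≤ ENNReal.ofReal (Real.exp (n * d * (s * L) ^ 2 / 2)) := by
  have h := lintegral_prod_le_pow (P := P) (𝒢 := fun k : ℕ => basisSigma F₀ W (k * d))
    (fun k => basisSigma_le hW _) (fun k l hkl => basisSigma_mono F₀ W (by gcongr)) hf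
    (ξ := fun k ω => W i ((k + 1 : ℕ) * d) ω - W i (k * d) ω)
    (fun k => (measurable_basisSigma F₀ W i le_rfl).sub
      (measurable_basisSigma F₀ W i (by gcongr; exact k.le_succ)))
    (fun k => indep_increment_grid hW i k d) (fun k => map_increment hW i k d)
    (F := fun y => ENNReal.ofReal (Real.exp (s * g y.1 * y.2))) (by fun_prop)
    (c := ENNReal.ofReal (Real.exp (d * (s * L) ^ 2 / 2))) (fun a => by
      refine (lintegral_exp_mul_gaussianReal d (s * g a)).trans_le ?_
      gcongr ENNReal.ofReal (Real.exp (_ * ?_ / 2))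
      refine sq_le_sq.2 ?_
      rw [abs_mul, abs_mul]
      exact mul_le_mul_of_nonneg_left ((hL a).trans (le_abs_self L)) (abs_nonneg s)) n
  refine le_trans (le_of_eq ?_) (h.trans (le_of_eq ?_))
  · congr 1 with ω
    rw [← ENNReal.ofReal_prod_of_nonneg (fun k _ => (Real.exp_pos _).le), ← Real.exp_sum,
      Finset.mul_sum]
    simp only [mul_assoc]
  · rw [← ENNReal.ofReal_pow (Real.exp_pos _).le, ← Real.exp_nat_mul]
    congr 2; ring

lemma measure_stochasticSum_ge_le (hW : IsDrivingNoise F₀ W P) [IsProbabilityMeasure P]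
    (i : ℕ) (d : ℝ≥0) {f : ℕ → Ω → ℝ}
    (hf : ∀ k : ℕ, AEStronglyMeasurable[basisSigma F₀ W (k * d)] (f k) P)
    {g : ℝ → ℝ} (hg : Measurable g) {L : ℝ} (hL : ∀ x, |g x| ≤ L) (s : ℝ) (n : ℕ) (a : ℝ) :
    P {ω | a ≤ s * |∑ k ∈ Finset.range n,
        g (f k ω) * (W i ((k + 1 : ℕ) * d) ω - W i (k * d) ω)|}
      ≤ ENNReal.ofReal (2 * Real.exp (n * d * (s * L) ^ 2 / 2) * Real.exp (-a)) := by
  choose f' hf'm hf'e using hf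
  set S : Ω → ℝ := fun ω => ∑ k ∈ Finset.range n,
    g (f' k ω) * (W i ((k + 1 : ℕ) * d) ω - W i (k * d) ω) with hS
  have hfS : ∀ k, Measurable (f' k) := fun k =>
    (hf'm k).measurable.mono (basisSigma_le hW _) le_rfl
  have hSm : Measurable S := by
    refine Finset.measurable_fun_sum _ fun k _ => ?_
    exact (hg.comp (hfS k)).mul ((hW.measurable i _).sub (hW.measurable i _))
  have hb : ∀ r : ℝ, r ^ 2 = s ^ 2 → P {ω | a ≤ r * S ω} ≤
      ENNReal.ofReal (Real.exp (n * d * (s * L) ^ 2 / 2) * Real.exp (-a)) := by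
    intro r hr
    refine measure_le_exp_of_lintegral_exp (hSm.const_mul r).aemeasurable ?_ a
    have := lintegral_exp_stochasticSum_le hW i d (fun k => (hf'm k).measurable) hg hL r n
    rwa [mul_pow r L, hr, ← mul_pow] at this
  have hsub : {ω | a ≤ s * |∑ k ∈ Finset.range n,
        g (f k ω) * (W i ((k + 1 : ℕ) * d) ω - W i (k * d) ω)|} ≤ᵐ[P]
      ({ω | a ≤ s * S ω} ∪ {ω | a ≤ -s * S ω} : Set Ω) := by
    filter_upwards [ae_all_iff.2 hf'e] with ω hω h
    change a ≤ s * |_| at h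
    simp only [hω] at h
    change a ≤ s * |S ω| at h
    rcases abs_cases (S ω) with ⟨h1, -⟩ | ⟨h1, -⟩
    · left; change a ≤ _; rwa [h1] at h
    · right; change a ≤ _; rw [h1] at h; linarith
  refine (measure_mono_ae hsub).trans ((measure_union_le _ _).trans ?_)
  refine (add_le_add (hb s rfl) (hb (-s) (by ring))).trans (le_of_eq ?_)
  rw [← ENNReal.ofReal_add (by positivity) (by positivity)]
  congr 1; ring

/-- The lower tail of a `χ²` variable with `n` degrees of freedom. -/
lemma measure_quadraticVariation_le (hW : IsDrivingNoise F₀ W P) [IsProbabilityMeasure P]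
    (i : ℕ) {d : ℝ≥0} (hd : d ≠ 0) (n : ℕ) :
    P {ω | ∑ k ∈ Finset.range n, (W i ((k + 1 : ℕ) * d) ω - W i (k * d) ω) ^ 2 ≤ n * d / 4}
      ≤ ENNReal.ofReal (((√3)⁻¹ * Real.exp (1 / 4)) ^ n) := by
  have h := lintegral_prod_le_pow (P := P) (𝒢 := fun k : ℕ => basisSigma F₀ W (k * d))
    (fun k => basisSigma_le hW _) (fun k l hkl => basisSigma_mono F₀ W (by gcongr))
    (f := fun _ _ => (0 : ℝ)) (fun k => measurable_const)
    (ξ := fun k ω => W i ((k + 1 : ℕ) * d) ω - W i (k * d) ω)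
    (fun k => (measurable_basisSigma F₀ W i le_rfl).sub
      (measurable_basisSigma F₀ W i (by gcongr; exact k.le_succ)))
    (fun k => indep_increment_grid hW i k d) (fun k => map_increment hW i k d)
    (F := fun y => ENNReal.ofReal (Real.exp (-(y.2 ^ 2 / d)))) (by fun_prop)
    (fun a => (lintegral_exp_neg_sq_gaussianReal hd).le) n
  have hm : AEMeasurable (fun ω => ∑ k ∈ Finset.range n,
      -((W i ((k + 1 : ℕ) * d) ω - W i (k * d) ω) ^ 2 / d)) P := by
    refine (Finset.measurable_fun_sum _ fun k _ => ?_).aemeasurable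
    exact ((((hW.measurable i _).sub (hW.measurable i _)).pow_const 2).div_const _).neg
  have hc := measure_le_exp_of_lintegral_exp hm (c := (√3)⁻¹ ^ n) (by
    refine le_trans (le_of_eq ?_) (h.trans (le_of_eq ?_))
    · congr 1 with ω
      rw [← ENNReal.ofReal_prod_of_nonneg (fun k _ => (Real.exp_pos _).le), ← Real.exp_sum]
    · rw [← ENNReal.ofReal_pow (by positivity)]) (-(n / 4))
  refine (measure_mono fun ω hω => ?_).trans (hc.trans (le_of_eq ?_))
  · have hd' : (0 : ℝ) < d := by positivity
    rw [Set.mem_ofPred_eq]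
    rw [Finset.sum_neg_distrib, ← Finset.sum_div, neg_le_neg_iff, div_le_iff₀ hd']
    refine le_trans hω (le_of_eq (by ring))
  · rw [mul_pow, ← Real.exp_nat_mul]
    congr 3; ring

/-- Jensen's inequality for time averages, integrated over `Ω`. -/
lemma lintegral_exp_average_le [SFinite P] {g : ℝ → Ω → ℝ}
    (hg : Measurable (Function.uncurry g))
    (hcont : ∀ ω, Continuous (fun s => g s ω)) {a b : ℝ} (hab : a < b) {C : ℝ≥0∞}
    (h : ∀ s ∈ Set.Ioc a b, ∫⁻ ω, ENNReal.ofReal (Real.exp (g s ω)) ∂P ≤ C) :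
    ∫⁻ ω, ENNReal.ofReal (Real.exp ((b - a)⁻¹ * ∫ s in a..b, g s ω)) ∂P ≤ C := by
  have hba : 0 < b - a := sub_pos.2 hab
  have hpt : ∀ ω, ENNReal.ofReal (Real.exp ((b - a)⁻¹ * ∫ s in a..b, g s ω)) ≤
      ENNReal.ofReal (b - a)⁻¹ * ∫⁻ s in Set.Ioc a b, ENNReal.ofReal (Real.exp (g s ω)) := by
    intro ω
    have hI : IntegrableOn (fun s => g s ω) (Set.Ioc a b) :=
      ((hcont ω).intervalIntegrable a b).1
    have hE : IntegrableOn (fun s => Real.exp (g s ω)) (Set.Ioc a b) :=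
      ((Real.continuous_exp.comp (hcont ω)).intervalIntegrable a b).1
    have hJ := convexOn_exp.map_set_average_le (μ := volume) (t := Set.Ioc a b)
      (f := fun s => g s ω) Real.continuous_exp.continuousOn isClosed_univ
      (by simpa using hab) (by simp) (by simp) hI hE
    rw [setAverage_eq, setAverage_eq] at hJ
    simp only [Measure.real, Real.volume_Ioc, ENNReal.toReal_ofReal hba.le, smul_eq_mul] at hJ
    rw [intervalIntegral.integral_of_le hab.le]
    refine (ENNReal.ofReal_le_ofReal hJ).trans (le_of_eq ?_)
    rw [ENNReal.ofReal_mul (inv_nonneg.2 hba.le),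
      ofReal_integral_eq_lintegral_ofReal hE (ae_of_all _ fun s => (Real.exp_pos _).le)]
  have hm : Measurable (Function.uncurry fun (ω : Ω) (s : ℝ) =>
      ENNReal.ofReal (Real.exp (g s ω))) :=
    (Real.measurable_exp.comp (hg.comp measurable_swap)).ennreal_ofReal
  calc ∫⁻ ω, ENNReal.ofReal (Real.exp ((b - a)⁻¹ * ∫ s in a..b, g s ω)) ∂P
      ≤ ∫⁻ ω, (ENNReal.ofReal (b - a)⁻¹ *
          ∫⁻ s in Set.Ioc a b, ENNReal.ofReal (Real.exp (g s ω))) ∂P := lintegral_mono hpt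
    _ = ENNReal.ofReal (b - a)⁻¹ *
          ∫⁻ s in Set.Ioc a b, ∫⁻ ω, ENNReal.ofReal (Real.exp (g s ω)) ∂P := by
        rw [lintegral_const_mul' _ _ ENNReal.ofReal_ne_top, lintegral_lintegral_swap hm.aemeasurable]
    _ ≤ ENNReal.ofReal (b - a)⁻¹ * ∫⁻ _ in Set.Ioc a b, C := by
        exact mul_le_mul_right (setLIntegral_mono measurable_const h) _
    _ = C := by
        rw [setLIntegral_const, Real.volume_Ioc, mul_comm C, ← mul_assoc,
          ← ENNReal.ofReal_mul (inv_nonneg.2 hba.le), inv_mul_cancel₀ hba.ne']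
        simp

/-- Jensen's inequality for finite averages, integrated over `Ω`. -/
lemma lintegral_exp_sum_le {n : ℕ} (hn : n ≠ 0) {Z : ℕ → Ω → ℝ} (hZ : ∀ k, Measurable (Z k))
    {C : ℝ≥0∞} (h : ∀ k, ∫⁻ ω, ENNReal.ofReal (Real.exp (Z k ω)) ∂P ≤ C) :
    ∫⁻ ω, ENNReal.ofReal (Real.exp ((n : ℝ)⁻¹ * ∑ k ∈ Finset.range n, Z k ω)) ∂P ≤ C := by
  have hn' : (0 : ℝ) < n := by positivity
  have hpt : ∀ ω, ENNReal.ofReal (Real.exp ((n : ℝ)⁻¹ * ∑ k ∈ Finset.range n, Z k ω)) ≤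
      ENNReal.ofReal (n : ℝ)⁻¹ * ∑ k ∈ Finset.range n, ENNReal.ofReal (Real.exp (Z k ω)) := by
    intro ω
    have hJ := convexOn_exp.map_sum_le (t := Finset.range n) (w := fun _ => (n : ℝ)⁻¹)
      (p := fun k => Z k ω) (fun _ _ => by positivity) (by simp [hn'.ne']) (by simp)
    simp only [smul_eq_mul, ← Finset.mul_sum] at hJ
    refine (ENNReal.ofReal_le_ofReal hJ).trans (le_of_eq ?_)
    rw [ENNReal.ofReal_mul (inv_nonneg.2 hn'.le),
      ENNReal.ofReal_sum_of_nonneg fun k _ => (Real.exp_pos _).le]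
  have hm : ∀ k, Measurable fun ω => ENNReal.ofReal (Real.exp (Z k ω)) := fun k =>
    (Real.measurable_exp.comp (hZ k)).ennreal_ofReal
  calc ∫⁻ ω, ENNReal.ofReal (Real.exp ((n : ℝ)⁻¹ * ∑ k ∈ Finset.range n, Z k ω)) ∂P
      ≤ ∫⁻ ω, ENNReal.ofReal (n : ℝ)⁻¹ *
          ∑ k ∈ Finset.range n, ENNReal.ofReal (Real.exp (Z k ω)) ∂P := lintegral_mono hpt
    _ = ENNReal.ofReal (n : ℝ)⁻¹ *
          ∑ k ∈ Finset.range n, ∫⁻ ω, ENNReal.ofReal (Real.exp (Z k ω)) ∂P := by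
        rw [lintegral_const_mul' _ _ ENNReal.ofReal_ne_top,
          lintegral_finsetSum _ fun k _ => hm k]
    _ ≤ ENNReal.ofReal (n : ℝ)⁻¹ * ∑ k ∈ Finset.range n, C := by
        gcongr with k
        exact h k
    _ = C := by
        rw [Finset.sum_const, Finset.card_range, nsmul_eq_mul, ← mul_assoc,
          ← ENNReal.ofReal_natCast, ← ENNReal.ofReal_mul (inv_nonneg.2 hn'.le),
          inv_mul_cancel₀ hn'.ne']
        simp

lemma lintegral_exp_abs_increment_le {B : ℝ≥0 → Ω → ℝ} (hB : IsPreBrownianReal B P) (t u : ℝ≥0)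
    (c : ℝ) :
    ∫⁻ ω, ENNReal.ofReal (Real.exp (c * |B (t + u) ω - B t ω|)) ∂P
      ≤ ENNReal.ofReal (2 * Real.exp (u * c ^ 2 / 2)) := by
  have hlaw := (hB.shift t).hasLaw_eval u
  have hm := hlaw.aemeasurable
  have hr : ∀ r : ℝ, r ^ 2 = c ^ 2 →
      ∫⁻ ω, ENNReal.ofReal (Real.exp (r * (B (t + u) ω - B t ω))) ∂P
        = ENNReal.ofReal (Real.exp (u * c ^ 2 / 2)) := by
    intro r h
    have := lintegral_exp_mul_gaussianReal u r
    rw [← hlaw.map_eq, lintegral_map' (by fun_prop) hm, h] at this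
    exact this
  calc ∫⁻ ω, ENNReal.ofReal (Real.exp (c * |B (t + u) ω - B t ω|)) ∂P
      ≤ ∫⁻ ω, (ENNReal.ofReal (Real.exp (c * (B (t + u) ω - B t ω))) +
          ENNReal.ofReal (Real.exp (-c * (B (t + u) ω - B t ω)))) ∂P := by
        refine lintegral_mono fun ω => ?_
        rcases abs_choice (B (t + u) ω - B t ω) with h | h
        · simp only [h]; exact le_self_add
        · simp only [h]
          rw [mul_neg, ← neg_mul]; exact le_add_self
    _ = ENNReal.ofReal (2 * Real.exp (u * c ^ 2 / 2)) := by
        rw [lintegral_add_left' (by fun_prop), hr c rfl, hr (-c) (by ring),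
          ← ENNReal.ofReal_add (by positivity) (by positivity), two_mul]

/-- The average deviation of a Brownian motion from its last value on the grid of mesh `d` is of
order `√d`, with exponential tails uniform in the number of grid points. -/
lemma measure_average_deviation_ge_le [IsProbabilityMeasure P] {B : ℝ≥0 → Ω → ℝ}
    (hB : IsBrownianReal B P) (hBm : ∀ t, Measurable (B t)) {d : ℝ≥0} (hd : d ≠ 0)
    {n : ℕ} (hn : n ≠ 0) (a : ℝ) :
    P {ω | a * √d ≤ (n * d : ℝ)⁻¹ * ∑ k ∈ Finset.range n,
        ∫ s in (k * d : ℝ)..((k + 1 : ℕ) * d : ℝ), |B s.toNNReal ω - B (k * d) ω|}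
      ≤ ENNReal.ofReal (2 * Real.exp (1 / 2) * Real.exp (-a)) := by
  have hd0 : (0 : ℝ) < d := by positivity
  -- On a measurable null set the paths are replaced by `0`, which makes all of them continuous and
  -- hence the process jointly measurable.
  obtain ⟨N, hN, hNm, hN0⟩ := exists_measurable_superset_of_null (ae_iff.1 hB.cont)
  let B' : ℝ≥0 → Ω → ℝ := fun t => Nᶜ.indicator (B t)
  have hB'm : ∀ t, Measurable (B' t) := fun t => (hBm t).indicator hNm.compl
  have hB'c : ∀ ω, Continuous (fun t => B' t ω) := by
    intro ω
    by_cases h : ω ∈ N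
    · simp only [B', Set.indicator_of_notMem (Set.notMem_compl_iff.2 h)]
      exact continuous_const
    · simp only [B', Set.indicator_of_mem (Set.mem_compl h)]
      by_contra hc
      exact h (hN hc)
  have hBB' : ∀ᵐ ω ∂P, ∀ t, B t ω = B' t ω := by
    filter_upwards [compl_mem_ae_iff.2 hN0] with ω hω t
    simp only [B', Set.indicator_of_mem hω]
  have hB'pre : IsPreBrownianReal B' P :=
    hB.toIsPreBrownianReal.congr fun t => hBB'.mono fun ω h => h t
  let g : ℕ → ℝ → Ω → ℝ := fun k s ω => (√d)⁻¹ * |B' s.toNNReal ω - B' (k * d) ω|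
  have hgc : ∀ k ω, Continuous (fun s => g k s ω) := by
    intro k ω
    have := (hB'c ω).comp continuous_real_toNNReal
    exact continuous_const.mul ((this.sub continuous_const).abs)
  have hgm : ∀ k, Measurable (Function.uncurry (g k)) := by
    intro k
    have h := measurable_uncurry_of_continuous_of_measurable (u := g k) (fun ω => hgc k ω)
      (fun s => (((hB'm _).sub (hB'm _)).norm).const_mul _)
    exact h
  let Z : ℕ → Ω → ℝ := fun k ω =>
    (((k + 1 : ℕ) * d : ℝ) - k * d)⁻¹ * ∫ s in (k * d : ℝ)..((k + 1 : ℕ) * d : ℝ), g k s ω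
  have hlt : ∀ k : ℕ, (k * d : ℝ) < (k + 1 : ℕ) * d := by
    intro k; push_cast; nlinarith
  have hZm : ∀ k, Measurable (Z k) := by
    intro k
    refine Measurable.const_mul ?_ _
    simp only [intervalIntegral.integral_of_le (hlt k).le]
    exact (StronglyMeasurable.integral_prod_left' (hgm k).stronglyMeasurable).measurable
  have hZ : ∀ k, ∫⁻ ω, ENNReal.ofReal (Real.exp (Z k ω)) ∂P
      ≤ ENNReal.ofReal (2 * Real.exp (1 / 2)) := by
    intro k
    refine lintegral_exp_average_le (hgm k) (hgc k) (hlt k) fun s hs => ?_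
    have hks : (k * d : ℝ≥0) ≤ s.toNNReal := by
      rw [Real.le_toNNReal_iff_coe_le (le_trans (by positivity) hs.1.le)]
      push_cast; exact hs.1.le
    obtain ⟨u, hu⟩ := exists_add_of_le hks
    have hud : (u : ℝ) ≤ d := by
      have h1 := congrArg ((↑) : ℝ≥0 → ℝ) hu
      rw [Real.coe_toNNReal _ (le_trans (by positivity) hs.1.le)] at h1
      have h2 := hs.2
      push_cast at h1 h2
      linarith
    have h := lintegral_exp_abs_increment_le hB'pre (k * d) u (√d)⁻¹
    simp only [g, hu]
    refine h.trans (ENNReal.ofReal_le_ofReal ?_)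
    gcongr
    rw [inv_pow, Real.sq_sqrt hd0.le, ← div_eq_mul_inv]
    exact (div_le_one hd0).2 hud
  have hmain := measure_le_exp_of_lintegral_exp
    ((Finset.measurable_fun_sum (Finset.range n) fun k _ => hZm k).const_mul (n : ℝ)⁻¹).aemeasurable
    (lintegral_exp_sum_le hn hZm hZ) a
  refine (measure_mono_ae ?_).trans hmain
  filter_upwards [hBB'] with ω hω h
  change _ ≤ _ at h
  change _ ≤ _
  simp only [hω] at h
  have hs : 0 < √(d : ℝ) := Real.sqrt_pos.2 hd0
  refine le_of_mul_le_mul_right (h.trans (le_of_eq ?_)) hs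
  simp only [Z, g, intervalIntegral.integral_const_mul]
  rw [Finset.mul_sum, Finset.mul_sum, Finset.sum_mul]
  refine Finset.sum_congr rfl fun k _ => ?_
  have e : ((k + 1 : ℕ) * d : ℝ) - k * d = d := by push_cast; ring
  rw [e]
  field_simp

/-! ### The Dantzig selector on the event that the true parameter is feasible -/

variable {p : ℕ}

lemma score_sub_score (φ : ℕ → ℝ → ℝ) (n : ℕ) {Δ : ℝ} (hΔ : Δ ≠ 0) (x : ℕ → Fin p → ℝ)
    (i : Fin p) (θ₀ θ : Fin p → ℝ) :
    score φ n Δ x i θ₀ - score φ n Δ x i θ = hessian φ n Δ x i *ᵥ (θ - θ₀) := by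
  have e : 1 / (n * sigmaSqHat n Δ x i) = 1 / (n * Δ * sigmaSqHat n Δ x i) * Δ := by
    rw [mul_right_comm, div_mul_eq_mul_div, one_mul, div_mul_cancel_right₀ hΔ, one_div]
  ext j
  rw [hessian, score, score, Matrix.smul_mulVec, Matrix.sum_mulVec, ← smul_sub, e, mul_smul]
  simp only [Pi.smul_apply, smul_eq_mul, Pi.sub_apply, Finset.sum_apply, Matrix.vecMulVec_mulVec,
    ← Finset.sum_sub_distrib, dotProduct_sub, op_smul_eq_smul, smul_eq_mul, Finset.mul_sum]
  refine Finset.sum_congr rfl fun k _ => ?_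
  rw [dotProduct_comm _ θ, dotProduct_comm _ θ₀]
  ring

lemma abs_dotProduct_le (h v : Fin p → ℝ) : |h ⬝ᵥ v| ≤ l1On Finset.univ h * ‖v‖ := by
  rw [dotProduct, l1On, Finset.sum_mul]
  refine (Finset.abs_sum_le_sum_abs _ _).trans (Finset.sum_le_sum fun j _ => ?_)
  rw [abs_mul]
  exact mul_le_mul_of_nonneg_left (norm_le_pi_norm v j) (abs_nonneg _)

lemma l1On_add_l1On_compl (T : Finset (Fin p)) (h : Fin p → ℝ) :
    l1On T h + l1On Tᶜ h = l1On Finset.univ h :=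
  Finset.sum_add_sum_compl T _

/-- A vector whose `ℓ₁` norm does not exceed that of `θ₀` differs from `θ₀` by an element of the
cone of the support of `θ₀`. -/
lemma sub_mem_cone {θ₀ θ : Fin p → ℝ} (h : l1On Finset.univ θ ≤ l1On Finset.univ θ₀) :
    θ - θ₀ ∈ cone (supp θ₀) := by
  have h0 : ∀ j ∈ (supp θ₀)ᶜ, θ₀ j = 0 := by
    intro j hj
    simpa [supp] using hj
  have h1 : l1On (supp θ₀)ᶜ (θ - θ₀) = l1On (supp θ₀)ᶜ θ :=
    Finset.sum_congr rfl fun j hj => by simp [h0 j hj]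
  have h2 : l1On (supp θ₀)ᶜ θ₀ = 0 := Finset.sum_eq_zero fun j hj => by simp [h0 j hj]
  have h3 : l1On (supp θ₀) θ₀ ≤ l1On (supp θ₀) θ + l1On (supp θ₀) (θ - θ₀) := by
    rw [l1On, l1On, l1On, ← Finset.sum_add_distrib]
    refine Finset.sum_le_sum fun j _ => ?_
    have := abs_sub (θ j) (θ j - θ₀ j)
    simpa using this
  have h4 := l1On_add_l1On_compl (supp θ₀) θ
  have h5 := l1On_add_l1On_compl (supp θ₀) θ₀
  change l1On _ _ ≤ l1On _ _
  linarith

/-- The `ℓ₁` error of the Dantzig selector when the true parameter is feasible and the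
compatibility factor is bounded below. -/
lemma l1On_dantzig_sub_le {φ : ℕ → ℝ → ℝ} {n : ℕ} {Δ γ : ℝ} (hΔ : Δ ≠ 0)
    {x : ℕ → Fin p → ℝ} {i : Fin p} {θ₀ θ : Fin p → ℝ}
    (hfeas : ‖score φ n Δ x i θ₀‖ ≤ γ) (hθ : IsDantzigSelector φ n Δ γ x i θ) {δ : ℝ} (hδ : 0 < δ)
    (hκ : ENNReal.ofReal δ < kappa (supp θ₀) (hessian φ n Δ x i)) {S : ℕ}
    (hS : (supp θ₀).card ≤ S) :
    l1On Finset.univ (θ - θ₀) ≤ 8 * S * γ / δ ^ 2 := by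
  have hγ : 0 ≤ γ := (norm_nonneg _).trans hfeas
  set T := supp θ₀ with hT
  set V := hessian φ n Δ x i with hV
  set h := θ - θ₀ with hh
  have hcone : h ∈ cone T := sub_mem_cone (hθ.2 θ₀ hfeas)
  have hl1 : l1On Finset.univ h ≤ 2 * l1On T h := by
    have h1 := l1On_add_l1On_compl T h
    have h2 : l1On Tᶜ h ≤ l1On T h := hcone
    linarith
  by_cases hz : h = 0
  · have h1 : l1On Finset.univ h = 0 := by simp [hz, l1On]
    rw [h1]; positivity
  have hpos : 0 < l1On T h := by
    obtain ⟨j, hj⟩ := Function.ne_iff.1 hz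
    have h1 : |h j| ≤ l1On Finset.univ h :=
      Finset.single_le_sum (f := fun j => |h j|) (fun _ _ => abs_nonneg _) (Finset.mem_univ j)
    have h2 : 0 < |h j| := abs_pos.2 hj
    linarith
  have hVh : ‖V *ᵥ h‖ ≤ 2 * γ := by
    rw [hV, hh, ← score_sub_score φ n hΔ x i θ₀ θ]
    refine (norm_sub_le _ _).trans ?_
    have h1 : ‖score φ n Δ x i θ‖ ≤ γ := hθ.1
    linarith
  have hquad : h ⬝ᵥ (V *ᵥ h) ≤ 4 * γ * l1On T h := by
    refine (le_abs_self _).trans ((abs_dotProduct_le _ _).trans ?_)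
    calc l1On Finset.univ h * ‖V *ᵥ h‖ ≤ (2 * l1On T h) * (2 * γ) := by
          gcongr
      _ = 4 * γ * l1On T h := by ring
  have hk : δ < √(T.card : ℝ) * √(h ⬝ᵥ (V *ᵥ h)) / l1On T h := by
    have h1 := lt_of_lt_of_le hκ (iInf₂_le h (show h ≠ 0 ∧ h ∈ cone T from ⟨hz, hcone⟩))
    exact (ENNReal.ofReal_lt_ofReal_iff_of_nonneg hδ.le).1 h1
  rw [lt_div_iff₀ hpos, ← Real.sqrt_mul (Nat.cast_nonneg _)] at hk
  have hk2 : (δ * l1On T h) ^ 2 < T.card * (h ⬝ᵥ (V *ᵥ h)) :=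
    (Real.lt_sqrt (by positivity)).1 hk
  have hTS : (T.card : ℝ) ≤ S := by exact_mod_cast hS
  have h3 : (δ * l1On T h) ^ 2 ≤ S * (4 * γ * l1On T h) :=
    hk2.le.trans ((mul_le_mul_of_nonneg_left hquad (Nat.cast_nonneg _)).trans (by gcongr))
  have h4 : δ ^ 2 * l1On T h ≤ 4 * S * γ := by
    refine le_of_mul_le_mul_right (le_trans (le_of_eq ?_) (h3.trans (le_of_eq ?_))) hpos <;> ring
  rw [le_div_iff₀ (by positivity)]
  nlinarith [sq_nonneg δ]

lemma thresholdSupp_eq_supp {γ K : ℝ} {θ₀ θ : Fin p → ℝ}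
    (herr : l1On Finset.univ (θ - θ₀) ≤ √γ) (hK : 2 * √γ ≤ K) (hθ₀ : ∀ j ∈ supp θ₀, K < |θ₀ j|) :
    thresholdSupp γ θ = supp θ₀ := by
  have hj : ∀ j, |θ j - θ₀ j| ≤ √γ := fun j =>
    (Finset.single_le_sum (f := fun j => |(θ - θ₀) j|) (fun _ _ => abs_nonneg _)
      (Finset.mem_univ j)).trans herr
  ext j
  by_cases h : j ∈ supp θ₀
  · have h1 := hθ₀ j h
    have h2 := hj j
    have h3 := abs_sub_abs_le_abs_sub (θ₀ j) (θ j)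
    rw [abs_sub_comm] at h3
    simp only [h, thresholdSupp, Finset.mem_filter, Finset.mem_univ, true_and, iff_true]
    linarith
  · have h0 : θ₀ j = 0 := by simpa [supp] using h
    have h2 := hj j
    rw [h0, sub_zero] at h2
    simp only [h, thresholdSupp, Finset.mem_filter, Finset.mem_univ, true_and, iff_false, not_lt]
    exact h2

/-! ### Bounds along a single path of the diffusion -/

/-- A continuous path `x` driven by `w`, together with bounds on the coefficients of the equation:
`|φ_j| ≤ L`, `φ_j` is `L'`-Lipschitz, `|Θ_ij| ≤ K`, `K₄ ≤ |σ_i| ≤ K₃`, and every row of `Θ` has at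
most `S` nonzero entries. -/
structure IsBoundedPath (φ : ℕ → ℝ → ℝ) (Θ : Matrix (Fin p) (Fin p) ℝ) (σ : Fin p → ℝ)
    (x : ℝ≥0 → Fin p → ℝ) (w : ℕ → ℝ≥0 → ℝ) (L L' K K₃ K₄ : ℝ) (S : ℕ) : Prop where
  continuous : Continuous x
  continuous_noise : ∀ j, Continuous (w j)
  equation : ∀ (t : ℝ≥0) (i : Fin p),
    x t i = x 0 i + (∫ s in (0 : ℝ)..(t : ℝ), Θ i ⬝ᵥ phiVec φ (x s.toNNReal)) + σ i * w i t
  L_nonneg : 0 ≤ L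
  L'_nonneg : 0 ≤ L'
  K_nonneg : 0 ≤ K
  K₄_pos : 0 < K₄
  phi_bounded : ∀ i y, |φ i y| ≤ L
  phi_lipschitz : ∀ i y z, |φ i y - φ i z| ≤ L' * |y - z|
  drift : ∀ i j, |Θ i j| ≤ K
  diffusion : ∀ i, K₄ ≤ |σ i| ∧ |σ i| ≤ K₃
  sparse : ∀ i, (supp (Θ i)).card ≤ S

lemma continuous_of_abs_sub_le {f : ℝ → ℝ} {C : ℝ} (hf : ∀ y z, |f y - f z| ≤ C * |y - z|) :
    Continuous f :=
  (LipschitzWith.of_dist_le' fun y z => by simpa [Real.dist_eq] using hf y z).continuous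

namespace IsBoundedPath

variable {φ : ℕ → ℝ → ℝ} {Θ : Matrix (Fin p) (Fin p) ℝ} {σ : Fin p → ℝ}
    {x : ℝ≥0 → Fin p → ℝ} {w : ℕ → ℝ≥0 → ℝ} {L L' K K₃ K₄ : ℝ} {S : ℕ}

lemma abs_dotProduct_le (h : IsBoundedPath φ Θ σ x w L L' K K₃ K₄ S) (i : Fin p) (v : Fin p → ℝ) :
    |Θ i ⬝ᵥ v| ≤ ∑ l ∈ supp (Θ i), K * |v l| := by
  have h1 : Θ i ⬝ᵥ v = ∑ l ∈ supp (Θ i), Θ i l * v l := by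
    refine (Finset.sum_subset (Finset.subset_univ _) fun l _ hl => ?_).symm
    have : Θ i l = 0 := by simpa [supp] using hl
    rw [this, zero_mul]
  rw [h1]
  refine (Finset.abs_sum_le_sum_abs _ _).trans (Finset.sum_le_sum fun l _ => ?_)
  rw [abs_mul]
  exact mul_le_mul_of_nonneg_right (h.drift i l) (abs_nonneg _)

lemma abs_drift_le (h : IsBoundedPath φ Θ σ x w L L' K K₃ K₄ S) (i : Fin p) (y : Fin p → ℝ) :
    |Θ i ⬝ᵥ phiVec φ y| ≤ S * (K * L) := by
  have := h.K_nonneg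
  have := h.L_nonneg
  refine (h.abs_dotProduct_le i _).trans ?_
  calc ∑ l ∈ supp (Θ i), K * |phiVec φ y l| ≤ ∑ l ∈ supp (Θ i), K * L :=
        Finset.sum_le_sum fun l _ => mul_le_mul_of_nonneg_left (h.phi_bounded _ _) h.K_nonneg
    _ = (supp (Θ i)).card * (K * L) := by rw [Finset.sum_const, nsmul_eq_mul]
    _ ≤ S * (K * L) := by
        gcongr
        exact h.sparse i

lemma continuous_phiVec (h : IsBoundedPath φ Θ σ x w L L' K K₃ K₄ S) :
    Continuous (fun s : ℝ => phiVec φ (x s.toNNReal)) :=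
  continuous_pi fun j => (continuous_of_abs_sub_le (h.phi_lipschitz j)).comp
    ((continuous_apply j).comp (h.continuous.comp continuous_real_toNNReal))

lemma continuous_drift (h : IsBoundedPath φ Θ σ x w L L' K K₃ K₄ S) (i : Fin p) :
    Continuous (fun s : ℝ => Θ i ⬝ᵥ phiVec φ (x s.toNNReal)) :=
  continuous_const.dotProduct h.continuous_phiVec

lemma sub_eq (h : IsBoundedPath φ Θ σ x w L L' K K₃ K₄ S) (i : Fin p) (s t : ℝ≥0) :
    x t i - x s i = (∫ r in (s : ℝ)..(t : ℝ), Θ i ⬝ᵥ phiVec φ (x r.toNNReal))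
      + σ i * (w i t - w i s) := by
  have hi := fun a b => (h.continuous_drift i).intervalIntegrable (μ := volume) a b
  rw [h.equation t i, h.equation s i, ← intervalIntegral.integral_interval_sub_left (hi 0 t) (hi 0 s)]
  ring

lemma abs_sub_sub_le (h : IsBoundedPath φ Θ σ x w L L' K K₃ K₄ S) (i : Fin p) (s t : ℝ≥0) :
    |x t i - x s i - σ i * (w i t - w i s)| ≤ S * (K * L) * |(t : ℝ) - s| := by
  rw [h.sub_eq i s t, add_sub_cancel_right]
  exact intervalIntegral.norm_integral_le_of_norm_le_const
    (f := fun r : ℝ => Θ i ⬝ᵥ phiVec φ (x r.toNNReal)) fun r _ => h.abs_drift_le i _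

lemma sigmaSqHat_ge (h : IsBoundedPath φ Θ σ x w L L' K K₃ K₄ S) {n : ℕ} (hn : n ≠ 0) {d : ℝ≥0}
    (hd : d ≠ 0) (hsmall : (S * (K * L)) ^ 2 * d ≤ K₄ ^ 2 / 16) (i : Fin p)
    (hqv : n * d / 4 ≤ ∑ k ∈ Finset.range n, (w i ((k + 1 : ℕ) * d) - w i (k * d)) ^ 2) :
    K₄ ^ 2 / 16 ≤ sigmaSqHat n d (fun k => x (k * d)) i := by
  have hd0 : (0 : ℝ) < d := by positivity
  have hn0 : (0 : ℝ) < n := by positivity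
  set D := S * (K * L) with hD
  have hk : ∀ k ∈ Finset.range n,
      K₄ ^ 2 / 2 * (w i ((k + 1 : ℕ) * d) - w i (k * d)) ^ 2 - D ^ 2 * d ^ 2
        ≤ |x ((k + 1 : ℕ) * d) i - x (k * d) i| ^ 2 := by
    intro k _
    have h1 := h.abs_sub_sub_le i (k * d) ((k + 1 : ℕ) * d)
    set u := w i ((k + 1 : ℕ) * d) - w i (k * d)
    set y := x ((k + 1 : ℕ) * d) i - x (k * d) i
    have e : |(((k + 1 : ℕ) * d : ℝ≥0) : ℝ) - ((k * d : ℝ≥0) : ℝ)| = d := by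
      push_cast
      rw [show ((k : ℝ) + 1) * d - k * d = d by ring, abs_of_pos hd0]
    rw [e, ← hD] at h1
    have h2 : (y - σ i * u) ^ 2 ≤ (D * d) ^ 2 :=
      sq_le_sq.2 (h1.trans (le_abs_self _))
    have h3 : K₄ ^ 2 ≤ σ i ^ 2 :=
      sq_le_sq.2 (by rw [abs_of_pos h.K₄_pos]; exact (h.diffusion i).1)
    have h4 : K₄ ^ 2 * u ^ 2 ≤ σ i ^ 2 * u ^ 2 := by gcongr
    rw [sq_abs]
    -- `(σu)² / 2 ≤ y² + (y - σu)²`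
    nlinarith [sq_nonneg (2 * y - σ i * u)]
  have hsum := Finset.sum_le_sum hk
  rw [Finset.sum_sub_distrib, ← Finset.mul_sum, Finset.sum_const, Finset.card_range,
    nsmul_eq_mul] at hsum
  rw [sigmaSqHat, one_div, le_inv_mul_iff₀ (by positivity)]
  refine le_trans ?_ hsum
  have h5 : K₄ ^ 2 / 2 * (n * d / 4) ≤ K₄ ^ 2 / 2 *
      ∑ k ∈ Finset.range n, (w i ((k + 1 : ℕ) * d) - w i (k * d)) ^ 2 := by gcongr
  have h6 : n * d * (D ^ 2 * d) ≤ n * d * (K₄ ^ 2 / 16) := by gcongr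
  nlinarith

/-- The error of freezing the drift at the left end of an observation interval. -/
lemma abs_integral_drift_sub_le (h : IsBoundedPath φ Θ σ x w L L' K K₃ K₄ S) (d : ℝ≥0)
    (i : Fin p) (k : ℕ) :
    |(∫ s in (k * d : ℝ)..((k + 1 : ℕ) * d : ℝ), Θ i ⬝ᵥ phiVec φ (x s.toNNReal))
        - (Θ i ⬝ᵥ phiVec φ (x (k * d))) * d|
      ≤ ∑ l ∈ supp (Θ i), K * (L' * (S * (K * L) * d * d
          + K₃ * ∫ s in (k * d : ℝ)..((k + 1 : ℕ) * d : ℝ), |w l s.toNNReal - w l (k * d)|)) := by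
  set D := S * (K * L) with hD
  have hL := h.L_nonneg
  have hL' := h.L'_nonneg
  have hK := h.K_nonneg
  have hD0 : 0 ≤ D := by positivity
  have hle : (k * d : ℝ) ≤ (k + 1 : ℕ) * d := by push_cast; nlinarith [d.coe_nonneg]
  have hlen : ((k + 1 : ℕ) * d : ℝ) - k * d = d := by push_cast; ring
  have hwc : ∀ l : ℕ, Continuous fun s : ℝ => |w l s.toNNReal - w l (k * d)| := fun l =>
    (((h.continuous_noise l).comp continuous_real_toNNReal).sub continuous_const).abs
  have e : (∫ s in (k * d : ℝ)..((k + 1 : ℕ) * d : ℝ), Θ i ⬝ᵥ phiVec φ (x s.toNNReal))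
      - (Θ i ⬝ᵥ phiVec φ (x (k * d))) * d
      = ∫ s in (k * d : ℝ)..((k + 1 : ℕ) * d : ℝ),
        Θ i ⬝ᵥ (phiVec φ (x s.toNNReal) - phiVec φ (x (k * d))) := by
    simp only [dotProduct_sub]
    rw [intervalIntegral.integral_sub ((h.continuous_drift i).intervalIntegrable _ _)
      (continuous_const.intervalIntegrable _ _), intervalIntegral.integral_const, hlen,
      smul_eq_mul, mul_comm (d : ℝ)]
  have hpt : ∀ s ∈ Set.Ioc (k * d : ℝ) ((k + 1 : ℕ) * d : ℝ),
      ‖Θ i ⬝ᵥ (phiVec φ (x s.toNNReal) - phiVec φ (x (k * d)))‖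
        ≤ ∑ l ∈ supp (Θ i), K * (L' * (D * d + K₃ * |w l s.toNNReal - w l (k * d)|)) := by
    intro s hs
    refine (h.abs_dotProduct_le i _).trans (Finset.sum_le_sum fun l _ => ?_)
    refine mul_le_mul_of_nonneg_left ?_ hK
    refine (h.phi_lipschitz _ _ _).trans (mul_le_mul_of_nonneg_left ?_ hL')
    have h1 := h.abs_sub_sub_le l (k * d) s.toNNReal
    have hs0 : 0 ≤ s := le_trans (by positivity) hs.1.le
    rw [← hD, Real.coe_toNNReal _ hs0] at h1
    push_cast at h1
    have h2 : |s - k * d| ≤ d := by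
      rw [abs_of_nonneg (by linarith [hs.1])]
      linarith [hs.2]
    have h3 := abs_add_le (x s.toNNReal l - x (k * d) l - σ l * (w l s.toNNReal - w l (k * d)))
      (σ l * (w l s.toNNReal - w l (k * d)))
    rw [sub_add_cancel, abs_mul] at h3
    have h4 : |σ l| * |w l s.toNNReal - w l (k * d)| ≤ K₃ * |w l s.toNNReal - w l (k * d)| :=
      mul_le_mul_of_nonneg_right (h.diffusion l).2 (abs_nonneg _)
    have h5 : D * |s - k * d| ≤ D * d := mul_le_mul_of_nonneg_left h2 hD0
    linarith
  have hc : ∀ l : Fin p, Continuous fun s : ℝ =>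
      K * (L' * (D * d + K₃ * |w l s.toNNReal - w l (k * d)|)) := fun l =>
    continuous_const.mul (continuous_const.mul (continuous_const.add
      (continuous_const.mul (hwc l))))
  rw [e, ← Real.norm_eq_abs]
  refine (intervalIntegral.norm_integral_le_of_norm_le hle (ae_of_all _ hpt)
    ((continuous_finsetSum _ fun l _ => hc l).intervalIntegrable _ _)).trans (le_of_eq ?_)
  rw [intervalIntegral.integral_finsetSum fun l _ => (hc l).intervalIntegrable _ _]
  refine Finset.sum_congr rfl fun l _ => ?_
  have hw : Continuous fun s : ℝ => K₃ * |w l s.toNNReal - w l (k * d)| :=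
    continuous_const.mul (hwc l)
  rw [intervalIntegral.integral_const_mul, intervalIntegral.integral_const_mul,
    intervalIntegral.integral_add (continuous_const.intervalIntegrable _ _)
      (hw.intervalIntegrable _ _),
    intervalIntegral.integral_const_mul K₃, intervalIntegral.integral_const, hlen, smul_eq_mul,
    mul_comm (d : ℝ)]

/-- The score at the true parameter is the sum of a normalized stochastic sum, controlled by `β`,
and a discretization error, controlled by the deviations `α` of the noise from its values on the
grid. -/
lemma norm_score_le (h : IsBoundedPath φ Θ σ x w L L' K K₃ K₄ S) {n : ℕ} (hn : n ≠ 0) {d : ℝ≥0}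
    (hd : d ≠ 0) (i : Fin p) {α β : ℝ} (hα0 : 0 ≤ α) (hβ0 : 0 ≤ β)
    (hσ : K₄ ^ 2 / 16 ≤ sigmaSqHat n d (fun k => x (k * d)) i)
    (hβ : ∀ j : Fin p, |∑ k ∈ Finset.range n,
      φ j (x (k * d) j) * (w i ((k + 1 : ℕ) * d) - w i (k * d))| ≤ n * d * β)
    (hα : ∀ l : Fin p, (n * d : ℝ)⁻¹ * ∑ k ∈ Finset.range n,
      ∫ s in (k * d : ℝ)..((k + 1 : ℕ) * d : ℝ), |w l s.toNNReal - w l (k * d)| ≤ α) :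
    ‖score φ n d (fun k => x (k * d)) i (Θ i)‖
      ≤ 16 / K₄ ^ 2 * (K₃ * β + L * (S * (K * (L' * (S * (K * L) * d + K₃ * α))))) := by
  have hL := h.L_nonneg
  have hL' := h.L'_nonneg
  have hK := h.K_nonneg
  have hK₄ := h.K₄_pos
  have hK₃ : 0 ≤ K₃ := (abs_nonneg _).trans (h.diffusion i).2
  have hd0 : (0 : ℝ) < d := by positivity
  have hn0 : (0 : ℝ) < n := by positivity
  have hT : (0 : ℝ) < n * d := by positivity
  rw [pi_norm_le_iff_of_nonneg (by positivity)]
  intro j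
  set D := S * (K * L) with hD
  set s2 := sigmaSqHat n d (fun k => x (k * d)) i
  have hs2 : 0 < s2 := lt_of_lt_of_le (by positivity) hσ
  let E : ℕ → ℝ := fun k =>
    (∫ s in (k * d : ℝ)..((k + 1 : ℕ) * d : ℝ), Θ i ⬝ᵥ phiVec φ (x s.toNNReal))
        - (Θ i ⬝ᵥ phiVec φ (x (k * d))) * d
  let I : Fin p → ℕ → ℝ := fun l k =>
    ∫ s in (k * d : ℝ)..((k + 1 : ℕ) * d : ℝ), |w l s.toNNReal - w l (k * d)|
  have hscore : score φ n d (fun k => x (k * d)) i (Θ i) j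
      = (n * d * s2)⁻¹ * (σ i * (∑ k ∈ Finset.range n,
          φ j (x (k * d) j) * (w i ((k + 1 : ℕ) * d) - w i (k * d)))
        + ∑ k ∈ Finset.range n, φ j (x (k * d) j) * E k) := by
    rw [score, Pi.smul_apply, smul_eq_mul, one_div, Finset.sum_apply,
      Finset.mul_sum _ _ (σ i),
      ← Finset.sum_add_distrib]
    congr 1
    refine Finset.sum_congr rfl fun k _ => ?_
    have h1 := h.sub_eq i (k * d) ((k + 1 : ℕ) * d)
    simp only [Pi.smul_apply, smul_eq_mul]
    rw [h1]
    simp only [E, phiVec]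
    push_cast
    ring
  have hE : ∑ k ∈ Finset.range n, |φ j (x (k * d) j) * E k|
      ≤ n * d * (L * (S * (K * (L' * (D * d + K₃ * α))))) := by
    calc ∑ k ∈ Finset.range n, |φ j (x (k * d) j) * E k|
        ≤ ∑ k ∈ Finset.range n, L * ∑ l ∈ supp (Θ i), K * (L' * (D * d * d + K₃ * I l k)) := by
          refine Finset.sum_le_sum fun k _ => ?_
          rw [abs_mul]
          exact mul_le_mul (h.phi_bounded _ _) (h.abs_integral_drift_sub_le d i k) (abs_nonneg _) hL
      _ = L * ∑ l ∈ supp (Θ i), K * (L' * (n * d * (D * d) + K₃ * ∑ k ∈ Finset.range n, I l k)) := by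
          rw [← Finset.mul_sum, Finset.sum_comm]
          congr 1
          refine Finset.sum_congr rfl fun l _ => ?_
          rw [← Finset.mul_sum, ← Finset.mul_sum, Finset.sum_add_distrib,
            ← Finset.mul_sum _ _ K₃,
            Finset.sum_const, Finset.card_range, nsmul_eq_mul]
          ring
      _ ≤ L * ∑ l ∈ supp (Θ i), K * (L' * (n * d * (D * d) + K₃ * (n * d * α))) := by
          gcongr with l
          have := hα l
          rwa [inv_mul_le_iff₀ hT] at this
      _ = L * ((supp (Θ i)).card * (K * (L' * (n * d * (D * d) + K₃ * (n * d * α))))) := by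
          rw [Finset.sum_const, nsmul_eq_mul]
      _ ≤ L * (S * (K * (L' * (n * d * (D * d) + K₃ * (n * d * α))))) := by
          gcongr
          exact h.sparse i
      _ = n * d * (L * (S * (K * (L' * (D * d + K₃ * α))))) := by ring
  set R := L * (S * (K * (L' * (D * d + K₃ * α)))) with hR
  have hR0 : 0 ≤ R := by positivity
  have hnum : |σ i * (∑ k ∈ Finset.range n,
          φ j (x (k * d) j) * (w i ((k + 1 : ℕ) * d) - w i (k * d)))
        + ∑ k ∈ Finset.range n, φ j (x (k * d) j) * E k| ≤ n * d * (K₃ * β + R) := by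
    refine (abs_add_le _ _).trans ?_
    have h1 := mul_le_mul (h.diffusion i).2 (hβ j) (abs_nonneg _) hK₃
    rw [← abs_mul] at h1
    have h2 := (Finset.abs_sum_le_sum_abs (fun k : ℕ => φ j (x (k * d) j) * E k)
      (Finset.range n)).trans hE
    calc _ ≤ K₃ * (n * d * β) + n * d * R := add_le_add h1 h2
      _ = _ := by ring
  rw [hscore, Real.norm_eq_abs, abs_mul, abs_of_pos (inv_pos.2 (by positivity)),
    inv_mul_le_iff₀ (by positivity)]
  refine hnum.trans ?_
  have h16 : 1 ≤ s2 * (16 / K₄ ^ 2) := by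
    have := mul_le_mul_of_nonneg_right hσ (show (0 : ℝ) ≤ 16 / K₄ ^ 2 by positivity)
    refine le_trans (le_of_eq ?_) this
    field_simp
  calc n * d * (K₃ * β + R) = n * d * (1 * (K₃ * β + R)) := by ring
    _ ≤ n * d * (s2 * (16 / K₄ ^ 2) * (K₃ * β + R)) := by gcongr
    _ = _ := by ring

end IsBoundedPath

/-! ### The exceptional event -/

/-- The event that one of the stochastic sums `∑ φ_j(X^j) ΔW^i` reaches the level `u`, or that the
average deviation of some `W^j` from its values on the grid reaches the level `α`, or that the
realized quadratic variation of some `W^i` is at most a quarter of its expectation. -/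
def exceptionalSet {Ω : Type*} {p : ℕ} (φ : ℕ → ℝ → ℝ) (W : ℕ → ℝ≥0 → Ω → ℝ)
    (X : ℝ≥0 → Ω → Fin p → ℝ) (n : ℕ) (d : ℝ≥0) (u α : ℝ) : Set Ω :=
  (⋃ i : Fin p, ⋃ j : Fin p, {ω | u ≤ |∑ k ∈ Finset.range n,
      φ j (X (k * d) ω j) * (W i ((k + 1 : ℕ) * d) ω - W i (k * d) ω)|}) ∪
  ((⋃ j : Fin p, {ω | α ≤ (n * d : ℝ)⁻¹ * ∑ k ∈ Finset.range n,
      ∫ s in (k * d : ℝ)..((k + 1 : ℕ) * d : ℝ), |W j s.toNNReal ω - W j (k * d) ω|}) ∪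
  ⋃ i : Fin p, {ω | ∑ k ∈ Finset.range n,
      (W i ((k + 1 : ℕ) * d) ω - W i (k * d) ω) ^ 2 ≤ n * d / 4})

lemma measure_iUnion_fin_le {Ω : Type*} [MeasurableSpace Ω] {P : Measure Ω} {p : ℕ}
    {A : Fin p → Set Ω} {c : ℝ≥0∞} (h : ∀ i, P (A i) ≤ c) : P (⋃ i, A i) ≤ p * c := by
  refine (measure_iUnion_fintype_le P A).trans ((Finset.sum_le_sum fun i _ => h i).trans ?_)
  simp

/-- In terms of `q = log (1 + p²)`, each of the at most `p²` stochastic sums exceeds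
`a q √(n d)` with probability `O(e^{-3q})`, so that the union bound costs only a factor `e^q`. -/
lemma measure_exceptionalSet_le {Ω : Type*} {F₀ : MeasurableSpace Ω} [mΩ : MeasurableSpace Ω]
    {P : Measure Ω} [IsProbabilityMeasure P] {W : ℕ → ℝ≥0 → Ω → ℝ} (hW : IsDrivingNoise F₀ W P)
    {p : ℕ} {φ : ℕ → ℝ → ℝ} (hφm : ∀ j, Measurable (φ j)) {L : ℝ} (hL : ∀ j y, |φ j y| ≤ L)
    {X : ℝ≥0 → Ω → Fin p → ℝ}
    (hX : ∀ t i, AEStronglyMeasurable[basisSigma F₀ W t] (fun ω => X t ω i) P)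
    {n : ℕ} (hn : n ≠ 0) {d : ℝ≥0} (hd : d ≠ 0) {a q : ℝ} (ha : 0 < a)
    (hq : q = Real.log (1 + (p : ℝ) ^ 2))
    (hρ : ((√3)⁻¹ * Real.exp (1 / 4)) ^ n ≤ Real.exp (-(3 * q))) :
    P (exceptionalSet φ W X n d (a * q * √(n * d)) (3 * q * √d)) ≤
      ENNReal.ofReal ((2 * Real.exp ((3 / a * L) ^ 2 / 2) + (2 * Real.exp (1 / 2) + 1))
        * Real.exp (-(2 * q))) := by
  have hd0 : (0 : ℝ) < d := by positivity
  have hn0 : (0 : ℝ) < n := by positivity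
  have hT : 0 < √((n : ℝ) * d) := Real.sqrt_pos.2 (by positivity)
  have hexp : Real.exp q = 1 + (p : ℝ) ^ 2 := by rw [hq, Real.exp_log (by positivity)]
  have hp : (p : ℝ) ≤ Real.exp q := by rw [hexp]; nlinarith [sq_nonneg ((p : ℝ) - 1)]
  have hp2 : (p : ℝ) * p ≤ Real.exp q := by rw [hexp]; nlinarith
  have h1 : ∀ i j : Fin p, P {ω | a * q * √(n * d) ≤ |∑ k ∈ Finset.range n,
      φ j (X (k * d) ω j) * (W i ((k + 1 : ℕ) * d) ω - W i (k * d) ω)|} ≤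
      ENNReal.ofReal (2 * Real.exp ((3 / a * L) ^ 2 / 2) * Real.exp (-(3 * q))) := by
    intro i j
    have h := measure_stochasticSum_ge_le hW i d (f := fun k ω => X (k * d) ω j)
      (fun k => hX _ j) (hφm j) (hL j) (3 / (a * √(n * d))) n (3 * q)
    refine (measure_mono fun ω hω => ?_).trans (h.trans (le_of_eq ?_))
    · rw [Set.mem_ofPred_eq] at hω ⊢
      have := mul_le_mul_of_nonneg_left hω (show 0 ≤ 3 / (a * √(n * d)) by positivity)
      refine le_trans (le_of_eq ?_) this
      field_simp
    · have e : (n : ℝ) * d * (3 / (a * √(n * d)) * L) ^ 2 = (3 / a * L) ^ 2 := by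
        have h2 : √((n : ℝ) * d) ^ 2 = n * d := Real.sq_sqrt (by positivity)
        calc (n : ℝ) * d * (3 / (a * √(n * d)) * L) ^ 2
            = (3 / a * L) ^ 2 * (n * d / √(n * d) ^ 2) := by
              field_simp
          _ = _ := by rw [h2, div_self (by positivity), mul_one]
      rw [e]
  have h2 : ∀ j : Fin p, P {ω | 3 * q * √d ≤ (n * d : ℝ)⁻¹ * ∑ k ∈ Finset.range n,
      ∫ s in (k * d : ℝ)..((k + 1 : ℕ) * d : ℝ), |W j s.toNNReal ω - W j (k * d) ω|} ≤
      ENNReal.ofReal (2 * Real.exp (1 / 2) * Real.exp (-(3 * q))) := fun j =>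
    measure_average_deviation_ge_le (hW.brownian j) (hW.measurable j) hd hn (3 * q)
  have h3 : ∀ i : Fin p, P {ω | ∑ k ∈ Finset.range n,
      (W i ((k + 1 : ℕ) * d) ω - W i (k * d) ω) ^ 2 ≤ n * d / 4} ≤
      ENNReal.ofReal (Real.exp (-(3 * q))) := fun i =>
    (measure_quadraticVariation_le hW i hd n).trans (ENNReal.ofReal_le_ofReal hρ)
  refine (measure_union_le _ _).trans ((add_le_add (measure_iUnion_fin_le fun i =>
    measure_iUnion_fin_le (h1 i)) ((measure_union_le _ _).trans (add_le_add
    (measure_iUnion_fin_le h2) (measure_iUnion_fin_le h3)))).trans ?_)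
  rw [← ENNReal.ofReal_natCast, ← ENNReal.ofReal_mul (by positivity),
    ← ENNReal.ofReal_mul (by positivity), ← ENNReal.ofReal_mul (by positivity),
    ← ENNReal.ofReal_mul (by positivity), ← ENNReal.ofReal_add (by positivity) (by positivity),
    ← ENNReal.ofReal_add (by positivity) (by positivity)]
  refine ENNReal.ofReal_le_ofReal ?_
  have e : Real.exp (-(2 * q)) = Real.exp q * Real.exp (-(3 * q)) := by
    rw [← Real.exp_add]; ring_nf
  rw [e]
  set E := Real.exp (-(3 * q))
  set C₁ := 2 * Real.exp ((3 / a * L) ^ 2 / 2)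
  set C₂ := 2 * Real.exp (1 / 2)
  have hE : 0 < E := Real.exp_pos _
  have hC₁ : 0 < C₁ := by positivity
  have hC₂ : 0 < C₂ := by positivity
  calc (p : ℝ) * (p * (C₁ * E)) + (p * (C₂ * E) + p * E)
      = (p * p) * (C₁ * E) + p * ((C₂ + 1) * E) := by ring
    _ ≤ Real.exp q * (C₁ * E) + Real.exp q * ((C₂ + 1) * E) := by gcongr
    _ = (C₁ + (C₂ + 1)) * (Real.exp q * E) := by ring

/-- Outside the exceptional event the true parameter is feasible. -/
lemma IsBoundedPath.norm_score_le_of_notMem {Ω : Type*} {p : ℕ} {φ : ℕ → ℝ → ℝ}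
    {Θ : Matrix (Fin p) (Fin p) ℝ} {σ : Fin p → ℝ} {W : ℕ → ℝ≥0 → Ω → ℝ}
    {X : ℝ≥0 → Ω → Fin p → ℝ} {ω : Ω} {L L' K K₃ K₄ : ℝ} {S : ℕ}
    (h : IsBoundedPath φ Θ σ (fun t => X t ω) (fun j t => W j t ω) L L' K K₃ K₄ S)
    {n : ℕ} (hn : n ≠ 0) {d : ℝ≥0} (hd : d ≠ 0) {u α : ℝ} (hu : 0 ≤ u) (hα : 0 ≤ α)
    (hsmall : (S * (K * L)) ^ 2 * d ≤ K₄ ^ 2 / 16)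
    (hω : ω ∉ exceptionalSet φ W X n d u α) (i : Fin p) :
    ‖score φ n d (observe d X ω) i (Θ i)‖ ≤
      16 / K₄ ^ 2 * (K₃ * (u / (n * d)) + L * (S * (K * (L' * (S * (K * L) * d + K₃ * α))))) := by
  have hT : (0 : ℝ) < n * d := by positivity
  simp only [exceptionalSet, Set.mem_union, Set.mem_iUnion, Set.mem_ofPred_eq, not_or, not_exists,
    not_le] at hω
  obtain ⟨h1, h2, h3⟩ := hω
  refine h.norm_score_le hn hd i hα (by positivity) (h.sigmaSqHat_ge hn hd hsmall i (h3 i).le)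
    (fun j => ?_) (fun l => (h2 l).le)
  rw [mul_div_cancel₀ _ hT.ne']
  exact (h1 i j).le

/-! ### Asymptotics -/

lemma exp_quarter_div_sqrt_three_lt_one : (√3)⁻¹ * Real.exp (1 / 4) < 1 := by
  have h3 : (0 : ℝ) < √3 := by positivity
  rw [inv_mul_lt_iff₀ h3, mul_one]
  refine Real.lt_sqrt_of_sq_lt ?_
  rw [← Real.exp_nat_mul]
  have h1 : Real.exp ((2 : ℕ) * (1 / 4)) ≤ Real.exp 1 := Real.exp_le_exp.2 (by norm_num)
  have := Real.exp_one_lt_d9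
  linarith

lemma tendsto_log_one_add_sq {p : ℕ → ℕ} (hp : Tendsto p atTop atTop) :
    Tendsto (fun n => Real.log (1 + (p n : ℝ) ^ 2)) atTop atTop := by
  refine Real.tendsto_log_atTop.comp (tendsto_atTop_add_const_left _ _ ?_)
  exact (tendsto_pow_atTop two_ne_zero).comp (tendsto_natCast_atTop_atTop.comp hp)

lemma log_one_add_sq_isBigO {p : ℕ → ℕ} (hp : Tendsto p atTop atTop) :
    (fun n => Real.log (1 + (p n : ℝ) ^ 2)) =O[atTop] (fun n => Real.log (p n)) := by
  refine IsBigO.of_bound 3 ?_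
  filter_upwards [hp.eventually_ge_atTop 2] with n hn
  have h2 : (2 : ℝ) ≤ p n := by exact_mod_cast hn
  have h0 : (0 : ℝ) < p n := by linarith
  rw [Real.norm_of_nonneg (Real.log_nonneg (by nlinarith)),
    Real.norm_of_nonneg (Real.log_nonneg (by linarith))]
  have h3 : Real.log (1 + (p n : ℝ) ^ 2) ≤ Real.log ((p n : ℝ) ^ 3) :=
    Real.log_le_log (by positivity) (by nlinarith [sq_nonneg (p n : ℝ)])
  rw [Real.log_pow] at h3
  exact_mod_cast h3

lemma tendsto_mesh_zero {Δ : ℕ → ℝ≥0} {α : ℝ} (hα : 0 < α)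
    (h : (fun n => (Δ n : ℝ)) =O[atTop] (fun n : ℕ => (n : ℝ) ^ (-α))) :
    Tendsto (fun n => (Δ n : ℝ)) atTop (𝓝 0) :=
  h.trans_tendsto ((tendsto_rpow_neg_atTop hα).comp tendsto_natCast_atTop_atTop)

lemma tendsto_sqrt_mul_mesh_zero {Δ : ℕ → ℝ≥0} {α : ℝ} (hα : 1 / 2 < α)
    (h : (fun n => (Δ n : ℝ)) =O[atTop] (fun n : ℕ => (n : ℝ) ^ (-α))) :
    Tendsto (fun n : ℕ => √(n : ℝ) * Δ n) atTop (𝓝 0) := by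
  have h1 := (isBigO_refl (fun n : ℕ => √(n : ℝ)) atTop).mul h
  refine h1.trans_tendsto ?_
  have h2 := (tendsto_rpow_neg_atTop (show 0 < α - 1 / 2 by linarith)).comp
    (tendsto_natCast_atTop_atTop (R := ℝ))
  refine h2.congr' ?_
  filter_upwards [eventually_gt_atTop 0] with n hn
  have hn0 : (0 : ℝ) < n := by exact_mod_cast hn
  simp only [Function.comp_apply]
  rw [Real.sqrt_eq_rpow, ← Real.rpow_add hn0]
  congr 1; ring

lemma eventually_mesh_ne_zero {Δ : ℕ → ℝ≥0} {α : ℝ}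
    (h : (fun n : ℕ => (n : ℝ) ^ (-α)) =O[atTop] (fun n => (Δ n : ℝ))) :
    ∀ᶠ n in atTop, Δ n ≠ 0 := by
  obtain ⟨C, hC⟩ := h.bound
  filter_upwards [hC, eventually_gt_atTop 0] with n hn hn0 h0
  have hn0' : (0 : ℝ) < n := by exact_mod_cast hn0
  have : 0 < (n : ℝ) ^ (-α) := Real.rpow_pos_of_pos hn0' _
  rw [h0, Real.norm_of_nonneg this.le] at hn
  simp at hn
  linarith

/-- The union bound over `p` dimensions is absorbed by the exponential decay in the number of
observations. -/
lemma eventually_pow_le_exp {q : ℕ → ℝ} {Δ : ℕ → ℝ≥0}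
    (hq : q =o[atTop] (fun n : ℕ => √((n : ℝ) * Δ n)))
    (hΔ : Tendsto (fun n => (Δ n : ℝ)) atTop (𝓝 0)) {ρ : ℝ} (hρ0 : 0 < ρ) (hρ1 : ρ < 1) :
    ∀ᶠ n : ℕ in atTop, ρ ^ n ≤ Real.exp (-(3 * q n)) := by
  have hlog : 0 < -Real.log ρ := neg_pos.2 (Real.log_neg hρ0 hρ1)
  filter_upwards [hq.bound (show 0 < -Real.log ρ / 3 by positivity),
    hΔ.eventually_le_const one_pos] with n h1 h2
  rw [Real.norm_of_nonneg (Real.sqrt_nonneg _)] at h1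
  have h3 : √((n : ℝ) * Δ n) ≤ n := by
    refine Real.sqrt_le_iff.2 ⟨Nat.cast_nonneg _, ?_⟩
    rcases Nat.eq_zero_or_pos n with rfl | hn
    · simp
    · have : (1 : ℝ) ≤ n := by exact_mod_cast hn
      have := (Δ n).coe_nonneg
      nlinarith
  have h4 : q n ≤ -Real.log ρ / 3 * n :=
    (le_abs_self _).trans (h1.trans (mul_le_mul_of_nonneg_left h3 (by positivity)))
  rw [← Real.exp_log hρ0, ← Real.exp_nat_mul, Real.exp_le_exp]
  linarith

/-- The discretization error of the drift, of order `q √Δ`, is of smaller order than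
`q / √(n Δ)`, because `√n Δ → 0`. -/
lemma eventually_discretization_le {q : ℕ → ℝ} {Δ : ℕ → ℝ≥0} (hq : Tendsto q atTop atTop)
    (hΔ0 : ∀ᶠ n in atTop, Δ n ≠ 0) (hΔ : Tendsto (fun n => (Δ n : ℝ)) atTop (𝓝 0))
    (hsΔ : Tendsto (fun n : ℕ => √(n : ℝ) * Δ n) atTop (𝓝 0)) {A B η : ℝ} (hA : 0 ≤ A)
    (hη : 0 < η) :
    ∀ᶠ n : ℕ in atTop, A * Δ n + B * (3 * q n * √(Δ n)) ≤ η * (q n / √((n : ℝ) * Δ n)) := by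
  have h1 : Tendsto (fun n : ℕ => (A + B * 3) * (√(n : ℝ) * Δ n)) atTop (𝓝 0) := by
    simpa using hsΔ.const_mul (A + B * 3)
  filter_upwards [hq.eventually_ge_atTop 1, hΔ0, hΔ.eventually_le_const one_pos,
    h1.eventually_le_const hη, eventually_gt_atTop 0] with n hq1 hd hd1 hs hn
  have hn0 : (0 : ℝ) < n := by exact_mod_cast hn
  have hd0 : (0 : ℝ) < Δ n := by positivity
  have hsq : 0 < √(Δ n : ℝ) := Real.sqrt_pos.2 hd0
  have hss : √(Δ n : ℝ) * √(Δ n : ℝ) = Δ n := Real.mul_self_sqrt hd0.le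
  have hs1 : √(Δ n : ℝ) ≤ 1 := Real.sqrt_le_one.2 hd1
  have hdq : (Δ n : ℝ) ≤ q n * √(Δ n : ℝ) := by nlinarith
  have hT : 0 < √((n : ℝ) * Δ n) := Real.sqrt_pos.2 (by positivity)
  rw [← mul_div_assoc, le_div_iff₀ hT]
  calc (A * Δ n + B * (3 * q n * √(Δ n))) * √((n : ℝ) * Δ n)
      ≤ (A * (q n * √(Δ n)) + B * (3 * q n * √(Δ n))) * √((n : ℝ) * Δ n) := by gcongr
    _ = (A + B * 3) * (√(n : ℝ) * (√(Δ n) * √(Δ n))) * q n := by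
        rw [Real.sqrt_mul hn0.le]; ring
    _ ≤ η * q n := by rw [hss]; gcongr

end DantzigDiffusion

open DantzigDiffusion in
theorem theorem5p1 {Ω : Type*} (F₀ : MeasurableSpace Ω) [mΩ : MeasurableSpace Ω]
    (P : Measure Ω) [IsProbabilityMeasure P]
    (W : ℕ → ℝ≥0 → Ω → ℝ) (hW : DantzigDiffusion.IsDrivingNoise F₀ W P)
    (p : ℕ → ℕ) (Δ : ℕ → ℝ≥0) (φ : ℕ → ℝ → ℝ)
    (Θ₀ : ∀ n, Matrix (Fin (p n)) (Fin (p n)) ℝ) (σ₀ : ∀ n, Fin (p n) → ℝ)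
    (X : ∀ n, ℝ≥0 → Ω → Fin (p n) → ℝ)
    (hX : ∀ n, DantzigDiffusion.IsSolution F₀ W φ (Θ₀ n) (σ₀ n) (X n) P)
    (Sstar : ℕ) (hS : ∀ n i, (DantzigDiffusion.supp (Θ₀ n i)).card ≤ Sstar)
    (hreg : DantzigDiffusion.Regularity p Δ φ Θ₀ σ₀ X P)
    (hcomp : DantzigDiffusion.CompatibilityCondition p Δ φ Θ₀ X P)
    (γ : ℕ → ℝ) (hγ_pos : ∀ n, 0 < γ n)
    (hγ : γ =Θ[atTop] (fun n : ℕ => Real.log (1 + (p n : ℝ) ^ 2) / √((n : ℝ) * Δ n)))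
    (Θhat : ∀ n, Ω → Fin (p n) → Fin (p n) → ℝ)
    (hΘhat_meas : ∀ n, AEMeasurable (Θhat n) P)
    (hΘhat : ∀ n, ∀ᵐ ω ∂P, ∀ i, DantzigDiffusion.IsDantzigSelector φ n (Δ n) (γ n)
      (DantzigDiffusion.observe (Δ n) (X n) ω) i (Θhat n ω i)) :
    Tendsto (fun n => P {ω | ∀ i : Fin (p n),
      DantzigDiffusion.thresholdSupp (γ n) (Θhat n ω i) = DantzigDiffusion.supp (Θ₀ n i)})
      atTop (𝓝 1) := by
  obtain ⟨L, hL0, hL⟩ := hreg.phi_bounded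
  obtain ⟨L', hL'0, hL'⟩ := hreg.phi_lipschitz
  obtain ⟨K₁, K₂, hK₁, hK₂, hΘ, hΘ'⟩ := hreg.drift_bounds
  obtain ⟨K₃, K₄, hK₃, hK₄, hσ⟩ := hreg.diffusion_bounds
  obtain ⟨α, hα, -, hmesh⟩ := hreg.mesh
  set q : ℕ → ℝ := fun n => Real.log (1 + (p n : ℝ) ^ 2) with hq
  have hq_top : Tendsto q atTop atTop := tendsto_log_one_add_sq hreg.dim_tendsto
  have hq_o : q =o[atTop] (fun n : ℕ => √((n : ℝ) * Δ n)) :=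
    (log_one_add_sq_isBigO hreg.dim_tendsto).trans_isLittleO hreg.log_dim
  have hΔ_ne := eventually_mesh_ne_zero hmesh.2
  have hΔ_zero := tendsto_mesh_zero (by linarith : 0 < α) hmesh.1
  have hsΔ := tendsto_sqrt_mul_mesh_zero hα hmesh.1
  have hγ_zero : Tendsto γ atTop (𝓝 0) := hγ.1.trans_tendsto hq_o.tendsto_div_nhds_zero
  have hsγ : Tendsto (fun n => √(γ n)) atTop (𝓝 0) := by
    simpa [Function.comp_def] using (Real.continuous_sqrt.tendsto 0).comp hγ_zero
  obtain ⟨c', hc'0, hc'⟩ := hγ.2.exists_pos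
  -- `a` is such that the stochastic part of the score uses up at most half of `γ`.
  set a : ℝ := K₄ ^ 2 / (32 * c' * K₃) with ha_def
  have ha : 0 < a := by positivity
  set C : ℝ := 2 * Real.exp ((3 / a * L) ^ 2 / 2) + (2 * Real.exp (1 / 2) + 1) with hC
  have hprob : Tendsto (fun n => C * Real.exp (-(2 * q n))) atTop (𝓝 0) := by
    have h1 : Tendsto (fun n => 2 * q n) atTop atTop := hq_top.const_mul_atTop two_pos
    simpa using (Real.tendsto_exp_neg_atTop_nhds_zero.comp h1).const_mul C
  have hpath : ∀ n, ∀ᵐ ω ∂P, IsBoundedPath φ (Θ₀ n) (σ₀ n) (fun t => X n t ω)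
      (fun j t => W j t ω) L L' K₁ K₃ K₄ Sstar := by
    intro n
    filter_upwards [(hX n).continuous, (hX n).equation,
      ae_all_iff.2 fun j => (hW.brownian j).cont] with ω h1 h2 h3
    exact ⟨h1, h3, h2, hL0.le, hL'0.le, hK₁.le, hK₄, hL, hL', fun i j => (hΘ n i j).le,
      fun i => ⟨(hσ n i).1.le, (hσ n i).2.le⟩, hS n⟩
  refine tendsto_order.2 ⟨fun b hb => ?_, fun b hb => Eventually.of_forall fun n =>
    prob_le_one.trans_lt hb⟩
  have hb' : b.toReal < 1 := by
    rw [← ENNReal.toReal_one]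
    exact (ENNReal.toReal_lt_toReal hb.ne_top ENNReal.one_ne_top).2 hb
  set ε : ℝ := (1 - b.toReal) / 3 with hε
  have hε0 : 0 < ε := by rw [hε]; linarith
  obtain ⟨δ, hδ, n₀, hn₀⟩ := hcomp ε hε0
  have hdisc := eventually_discretization_le hq_top hΔ_ne hΔ_zero hsΔ
    (A := L * (Sstar * (K₁ * (L' * (Sstar * (K₁ * L))))))
    (B := L * (Sstar * (K₁ * (L' * K₃)))) (η := K₄ ^ 2 / (32 * c')) (by positivity) (by positivity)
  have hsmall : ∀ᶠ n in atTop, (Sstar * (K₁ * L)) ^ 2 * (Δ n : ℝ) ≤ K₄ ^ 2 / 16 := by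
    have h := hΔ_zero.const_mul ((Sstar * (K₁ * L)) ^ 2)
    rw [mul_zero] at h
    exact h.eventually_le_const (by positivity)
  have hγ1 : ∀ᶠ n in atTop, 8 * Sstar / δ ^ 2 * √(γ n) ≤ 1 := by
    have h := hsγ.const_mul (8 * Sstar / δ ^ 2)
    rw [mul_zero] at h
    exact h.eventually_le_const one_pos
  have hγ2 : ∀ᶠ n in atTop, 2 * √(γ n) ≤ K₂ := by
    have h := hsγ.const_mul 2
    rw [mul_zero] at h
    exact h.eventually_le_const hK₂
  filter_upwards [eventually_ge_atTop n₀, eventually_ne_atTop 0, hΔ_ne, hdisc, hsmall, hγ1, hγ2,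
    hprob.eventually_le_const hε0, hq_top.eventually_ge_atTop 0, hc'.bound,
    eventually_pow_le_exp hq_o hΔ_zero (by positivity) exp_quarter_div_sqrt_three_lt_one]
    with n hn hn0 hd hdiscn hsmalln hγ1n hγ2n hprobn hqn hcn hρn
  have hn0' : (0 : ℝ) < n := by positivity
  have hd0 : (0 : ℝ) < Δ n := by positivity
  have hT0 : (0 : ℝ) < n * Δ n := by positivity
  have hT : 0 < √((n : ℝ) * Δ n) := Real.sqrt_pos.2 hT0
  have hcγ : q n / √((n : ℝ) * Δ n) ≤ c' * γ n := by
    rwa [Real.norm_of_nonneg (by positivity), Real.norm_of_nonneg (hγ_pos n).le] at hcn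
  set bad : Set Ω := exceptionalSet φ W (X n) n (Δ n) (a * q n * √(n * Δ n)) (3 * q n * √(Δ n))
  have hbad : P bad ≤ ENNReal.ofReal ε :=
    (measure_exceptionalSet_le hW (fun j => (continuous_of_abs_sub_le (hL' j)).measurable) hL
      (hX n).adapted hn0 hd ha rfl hρn).trans (ENNReal.ofReal_le_ofReal hprobn)
  have hsub : {ω | ENNReal.ofReal δ < ⨅ i : Fin (p n),
        kappa (supp (Θ₀ n i)) (hessian φ n (Δ n) (observe (Δ n) (X n) ω) i)} ≤ᵐ[P]
      ({ω | ∀ i : Fin (p n), thresholdSupp (γ n) (Θhat n ω i) = supp (Θ₀ n i)} ∪ bad : Set Ω) := by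
    filter_upwards [hpath n, hΘhat n] with ω hω hhat hκ
    change ENNReal.ofReal δ < _ at hκ
    by_cases hb : ω ∈ bad
    · exact Or.inr hb
    left
    intro i
    have hfeas : ‖score φ n (Δ n) (observe (Δ n) (X n) ω) i (Θ₀ n i)‖ ≤ γ n := by
      refine (hω.norm_score_le_of_notMem hn0 hd (by positivity) (by positivity) hsmalln hb i).trans ?_
      have e : a * q n * √(n * Δ n) / (n * Δ n) = a * (q n / √(n * Δ n)) := by
        rw [mul_assoc, mul_div_assoc, mul_div_assoc, Real.sqrt_div_self']
        ring
      rw [e]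
      calc 16 / K₄ ^ 2 * (K₃ * (a * (q n / √(n * Δ n)))
            + L * (Sstar * (K₁ * (L' * (Sstar * (K₁ * L) * Δ n + K₃ * (3 * q n * √(Δ n)))))))
          = 16 / K₄ ^ 2 * (K₃ * (a * (q n / √(n * Δ n)))
            + (L * (Sstar * (K₁ * (L' * (Sstar * (K₁ * L))))) * Δ n
              + L * (Sstar * (K₁ * (L' * K₃))) * (3 * q n * √(Δ n)))) := by ring
        _ ≤ 16 / K₄ ^ 2 * (K₃ * (a * (q n / √(n * Δ n)))
            + K₄ ^ 2 / (32 * c') * (q n / √(n * Δ n))) := by gcongr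
        _ = (q n / √(n * Δ n)) / c' := by
            rw [ha_def]; field_simp; ring
        _ ≤ γ n := by
            rw [div_le_iff₀ hc'0, mul_comm (γ n)]; exact hcγ
    have herr := l1On_dantzig_sub_le hd0.ne' hfeas (hhat i) hδ
      (lt_of_lt_of_le hκ (iInf_le _ i)) (hS n i)
    refine thresholdSupp_eq_supp (herr.trans ?_) hγ2n (hΘ' n i)
    have hs : √(γ n) * √(γ n) = γ n := Real.mul_self_sqrt (hγ_pos n).le
    calc 8 * Sstar * γ n / δ ^ 2 = 8 * Sstar / δ ^ 2 * √(γ n) * √(γ n) := by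
          rw [mul_assoc _ (√(γ n)), hs]; ring
      _ ≤ 1 * √(γ n) := by gcongr
      _ = √(γ n) := one_mul _
  have hfin := (hn₀ n hn).trans ((measure_mono_ae hsub).trans
    ((measure_union_le _ _).trans (add_le_add_right hbad _)))
  have h2ε : ENNReal.ofReal (1 - 2 * ε) ≤
      P {ω | ∀ i : Fin (p n), thresholdSupp (γ n) (Θhat n ω i) = supp (Θ₀ n i)} := by
    rw [show 1 - 2 * ε = (1 - ε) - ε by ring, ENNReal.ofReal_sub _ hε0.le]
    exact tsub_le_iff_right.2 hfin
  refine lt_of_lt_of_le ?_ h2ε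
  rw [ENNReal.lt_ofReal_iff_toReal_lt hb.ne_top, hε]
  linarith
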